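/- **Setting.** Let $(\mathbf\Omega,\mathcal F,\mathbb P)$ be a probability space and $D\in\mathbb N$; equip $\mathbb R^D$ with the max-norm and let $\chi_{\mathbf x}$ be multiplication by the indicator function of the open ball of radius $1/2$ around $\mathbf x\in\mathbb R^D$. A family $\omega\mapsto T(\omega)$ of self-adjoint operators in a Hilbert space is called measurable if $\omega\mapsto\langle\phi,(T(\omega)-z)^{-1}\psi\rangle$ is measurable for all $z\in\mathbb C\setminus\mathbb R$ and all vectors $\phi,\psi$. For a self-adjoint $T$ with pure point spectrum and $S\subset\mathbb R$, let $P_S(T)$ be the orthogonal projection onto the closed span of the eigenvectors of $T$ with eigenvalue in $S$, and $P_E(T)=P_{\{E\}}(T)$. Assume: * (H) $H(\omega)$, $\omega\in\mathbf\Omega$, is a measurable family of self-adjoint operators in $L^2(\mathbb R^D)$. * (O) $\mathfrak O$ is a family of open subsets of $\mathbb R^D$, and for every $\Omega\in\mathfrak O$ there is a restriction $H_\Omega$ of $H$ to $\Omega$: a measurable family of self-adjoint operators $H_\Omega(\omega)$ in $L^2(\Omega)$ such that $H_\Omega(\omega)$ and $H(\omega)$ agree on $\mathcal D(H_\Omega(\omega))\cap\mathcal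 D(H(\omega))$ (functions on $\Omega$ being extended by zero). For every $\omega$, $H_\Omega(\omega)$ has pure point spectrum, i.e. its eigenvectors span a dense subspace of $L^2(\Omega)$. * (M) $d$ is a pseudo-metric on $\mathbb R^D$ with $\sup_{\mathbf x\in\mathbb Z^D}\sum_{\mathbf y\in\mathbb Z^D}e^{-\mu d(\mathbf x,\mathbf y)^\gamma}<\infty$ for all $\mu>0$ and $\gamma\in(0,1]$. * (W) For every bounded interval $I\subset\mathbb R$ there is $C_I>0$ such that $\sup_{\mathbf x\in\mathbb R^D}\sup_{\Omega\in\mathfrak O}\mathbb E\big[\operatorname{Tr}(\chi_{\mathbf x}P_J(H_\Omega)\chi_{\mathbf x})\big]\le C_I|J|$ for every interval $J\subset I$. * (CT) There are $C_0,\mu_0>0$ such that for all $\mathbf x,\mathbf y\in\mathbb R^D$, all $\Omega\in\mathfrak O$, almost all $\omega$ and all $z\in\mathbb C\setminus\sigma(H_\Omega(\omega))$, with $\Delta=\operatorname{dist}(z,\sigma(H_\Omega(\omega)))$, $$\|\chi_{\mathbf x}(H_\Omega(\omega)-z)^{-1}\chi_{\mathbf y}\|\le\frac{C_0}{\Delta}\exp\Big(\frac{-\mu_0\Delta}{1+|z|+\Delta}\,d(\mathbf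 x,\mathbf y)\Big).$$ **Theorem.** Let $I\subset\mathbb R$ be a bounded interval and let $J\subset I$ be an interval with $\operatorname{dist}(J,\partial I)>0$. Suppose there are $C,\mu\in(0,\infty)$ and $\gamma\in(0,1]$ such that $$\sup_{\Omega\in\mathfrak O}\mathbb E\Big[\sum_{E\in\sigma(H_\Omega)\cap I}\|\chi_{\mathbf x}P_E(H_\Omega)\chi_{\mathbf y}\|\Big]\le Ce^{-\mu d(\mathbf x,\mathbf y)^\gamma}\qquad\text{for all }\mathbf x,\mathbf y\in\mathbb R^D.$$ Then for every $s\in(0,1)$ there are $A,\nu\in(0,\infty)$ such that $$\sup_{\Omega\in\mathfrak O}\ \sup_{\substack{\operatorname{Re}z\in J\\0<|\operatorname{Im}z|<1}}\mathbb E\big[\|\chi_{\mathbf x}(H_\Omega-z)^{-1}\chi_{\mathbf y}\|^s\big]\le Ae^{-\nu d(\mathbf x,\mathbf y)^\gamma}\qquad\text{for all }\mathbf x,\mathbf y\in\mathbb R^D.$$ -/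

import Mathlib

open MeasureTheory
open scoped ENNReal

noncomputable section

namespace RandomOperator

section AbstractOperators

variable {E : Type*} [NormedAddCommGroup E] [InnerProductSpace ℂ E]

/-- `R` is a bounded two-sided inverse of `T - z`, where `T` is an operator in `E` with domain
`T.domain`. -/
def IsResolventAt (T : E →ₗ.[ℂ] E) (z : ℂ) (R : E →L[ℂ] E) : Prop :=
  (∀ ψ : E, ∃ h : R ψ ∈ T.domain, T ⟨R ψ, h⟩ - z • R ψ = ψ) ∧
    ∀ φ : T.domain, R (T φ - z • (φ : E)) = φ

/-- The spectrum `σ(T)`: the set of those `z` for which `T - z` has no bounded inverse. -/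
def opSpectrum (T : E →ₗ.[ℂ] E) : Set ℂ :=
  {z | ¬ ∃ R : E →L[ℂ] E, IsResolventAt T z R}

open Classical in
/-- The resolvent `(T - z)⁻¹`; it is the (unique) bounded inverse of `T - z` for `z ∉ σ(T)`, and
`0` by convention for `z ∈ σ(T)`. -/
def opResolvent (T : E →ₗ.[ℂ] E) (z : ℂ) : E →L[ℂ] E :=
  if h : ∃ R : E →L[ℂ] E, IsResolventAt T z R then h.choose else 0

/-- The eigenspace `ker (T - a)`, a subspace of the domain of `T`. -/
def eigenspace (T : E →ₗ.[ℂ] E) (a : ℝ) : Submodule ℂ E :=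
  (LinearMap.ker (T.toFun - (a : ℂ) • T.domain.subtype)).map T.domain.subtype

/-- A self-adjoint operator has pure point spectrum if the span of its eigenvectors (whose
eigenvalues are real) is dense. -/
def HasPurePointSpectrum (T : E →ₗ.[ℂ] E) : Prop :=
  (⨆ a : ℝ, eigenspace T a).topologicalClosure = ⊤

/-- The spectral projection `P_S(T)` of a self-adjoint operator with pure point spectrum: the
orthogonal projection onto the closed span of the eigenspaces with eigenvalues in `S`. -/
def spectralProj [CompleteSpace E] (T : E →ₗ.[ℂ] E) (S : Set ℝ) : E →L[ℂ] E :=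
  (⨆ a ∈ S, eigenspace T a).topologicalClosure.starProjection

/-- The projection `P_a(T)` onto the eigenspace of `a`. -/
def eigenProj [CompleteSpace E] (T : E →ₗ.[ℂ] E) (a : ℝ) : E →L[ℂ] E :=
  spectralProj T {a}

/-- The trace in `[0, ∞]` of a non-negative bounded operator, computed in an orthonormal basis (the
value does not depend on the basis). -/
def posTrace [CompleteSpace E] (A : E →L[ℂ] E) : ℝ≥0∞ :=
  ∑' i : (exists_hilbertBasis ℂ E).choose,
    ENNReal.ofReal (inner ℂ (i : E) (A (i : E))).re

/-- A random operator `ω ↦ H ω` is a measurable family of self-adjoint operators if every `H ω` is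
self-adjoint and all the matrix elements of the resolvents at non-real points are measurable. -/
def IsMeasurableSelfAdjointFamily [CompleteSpace E] {Ω : Type*} [MeasurableSpace Ω]
    (H : Ω → E →ₗ.[ℂ] E) : Prop :=
  (∀ ω, IsSelfAdjoint (H ω)) ∧
    ∀ z : ℂ, z.im ≠ 0 → ∀ φ ψ : E, Measurable fun ω => inner ℂ φ (opResolvent (H ω) z ψ)

end AbstractOperators

section Multiplication

variable {α : Type*} [MeasurableSpace α] {m : Measure α}

/-- The class of `1_B f` for `f ∈ L²`. -/
def indicatorLp (m : Measure α) {B : Set α} (hB : MeasurableSet B) (f : Lp ℂ 2 m) : Lp ℂ 2 m :=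
  ((Lp.memLp f).indicator hB).toLp (B.indicator f)

theorem coeFn_indicatorLp {B : Set α} (hB : MeasurableSet B) (f : Lp ℂ 2 m) :
    (indicatorLp m hB f : α → ℂ) =ᵐ[m] B.indicator f :=
  MemLp.coeFn_toLp _

theorem indicatorLp_add {B : Set α} (hB : MeasurableSet B) (f g : Lp ℂ 2 m) :
    indicatorLp m hB (f + g) = indicatorLp m hB f + indicatorLp m hB g := by
  ext1
  filter_upwards [coeFn_indicatorLp hB (f + g), coeFn_indicatorLp hB f, coeFn_indicatorLp hB g,
    Lp.coeFn_add f g, Lp.coeFn_add (indicatorLp m hB f) (indicatorLp m hB g)] with x h1 h2 h3 h4 h5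
  rw [h1, h5, Pi.add_apply, h2, h3]
  by_cases hx : x ∈ B
  · simpa only [Set.indicator_of_mem hx, Pi.add_apply] using h4
  · simp [hx]

theorem indicatorLp_smul {B : Set α} (hB : MeasurableSet B) (c : ℂ) (f : Lp ℂ 2 m) :
    indicatorLp m hB (c • f) = c • indicatorLp m hB f := by
  ext1
  filter_upwards [coeFn_indicatorLp hB (c • f), coeFn_indicatorLp hB f, Lp.coeFn_smul c f,
    Lp.coeFn_smul c (indicatorLp m hB f)] with x h1 h2 h3 h4
  rw [h1, h4, Pi.smul_apply, h2]
  by_cases hx : x ∈ B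
  · simp [hx, h3]
  · simp [hx]

theorem norm_indicatorLp_le {B : Set α} (hB : MeasurableSet B) (f : Lp ℂ 2 m) :
    ‖indicatorLp m hB f‖ ≤ 1 * ‖f‖ := by
  rw [one_mul]
  refine Lp.norm_le_norm_of_ae_le ?_
  filter_upwards [coeFn_indicatorLp hB f] with x h1
  rw [h1]
  exact norm_indicator_le_norm_self _ _

/-- Multiplication on `L²` by the indicator function of a measurable set `B`. -/
def mulIndicator (m : Measure α) {B : Set α} (hB : MeasurableSet B) : Lp ℂ 2 m →L[ℂ] Lp ℂ 2 m :=
  LinearMap.mkContinuous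
    { toFun := indicatorLp m hB
      map_add' := indicatorLp_add hB
      map_smul' := indicatorLp_smul hB } 1 (norm_indicatorLp_le hB)

end Multiplication

section Space

variable {D : ℕ}

/-- `L²(U)` for `U ⊆ ℝ^D`, with Lebesgue measure. The space `Fin D → ℝ` carries the max-norm. -/
abbrev L2 (U : Set (Fin D → ℝ)) : Type :=
  Lp ℂ 2 ((volume : Measure (Fin D → ℝ)).restrict U)

/-- `χ_x`: multiplication on `L²(U)` by the indicator function of the open ball of radius `1/2`
around `x`, in the max-norm. -/
def chi (U : Set (Fin D → ℝ)) (x : Fin D → ℝ) : L2 U →L[ℂ] L2 U :=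
  mulIndicator (volume.restrict U) (measurableSet_ball (x := x) (ε := 1 / 2))

/-- `T` acts in `L²(U)`, `H` acts in `L²(ℝ^D)`, and, functions on `U` being extended by zero, both
operators agree on the vectors that lie in both domains. -/
def AgreesOnCommonDomain {U : Set (Fin D → ℝ)} (T : L2 U →ₗ.[ℂ] L2 U)
    (H : L2 (Set.univ : Set (Fin D → ℝ)) →ₗ.[ℂ] L2 (Set.univ : Set (Fin D → ℝ))) : Prop :=
  ∀ (φ : T.domain) (ψ : H.domain),
    ((ψ : L2 (Set.univ : Set (Fin D → ℝ))) : (Fin D → ℝ) → ℂ) =ᵐ[volume]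
        U.indicator ((φ : L2 U) : (Fin D → ℝ) → ℂ) →
      (H ψ : (Fin D → ℝ) → ℂ) =ᵐ[volume] U.indicator (T φ : (Fin D → ℝ) → ℂ)

/-- Finite-volume restrictions `HO U` of the random operator `H`, for the sets `U` of a family `𝔒`
of open sets: measurable families of self-adjoint operators in `L²(U)`, with pure point spectrum. -/
structure IsRestrictionFamily {Ω : Type*} [MeasurableSpace Ω] (𝔒 : Set (Set (Fin D → ℝ)))
    (H : Ω → L2 (Set.univ : Set (Fin D → ℝ)) →ₗ.[ℂ] L2 (Set.univ : Set (Fin D → ℝ)))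
    (HO : (U : Set (Fin D → ℝ)) → Ω → L2 U →ₗ.[ℂ] L2 U) : Prop where
  isOpen : ∀ U ∈ 𝔒, IsOpen U
  measurable_selfAdjoint : ∀ U ∈ 𝔒, IsMeasurableSelfAdjointFamily (HO U)
  agrees : ∀ U ∈ 𝔒, ∀ ω, AgreesOnCommonDomain (HO U ω) (H ω)
  purePoint : ∀ U ∈ 𝔒, ∀ ω, HasPurePointSpectrum (HO U ω)

/-- The summability condition
`sup_{x ∈ ℤ^D} ∑_{y ∈ ℤ^D} exp (-μ d(x,y)^γ) < ∞` for all `μ > 0` and `γ ∈ (0,1]`. -/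
def IsSummablePseudoMetric (d : PseudoMetric (Fin D → ℝ) ℝ) : Prop :=
  ∀ μ : ℝ, 0 < μ → ∀ γ ∈ Set.Ioc (0 : ℝ) 1,
    (⨆ x : Fin D → ℤ, ∑' y : Fin D → ℤ,
      ENNReal.ofReal (Real.exp (-μ * d (fun i => (x i : ℝ)) (fun i => (y i : ℝ)) ^ γ))) < ∞

/-- The Wegner estimate: for any bounded interval `I` there is `C_I > 0` with
`𝔼[Tr (χ_x P_J(H_U))] ≤ C_I |J|` for all intervals `J ⊆ I`, all `x` and all `U ∈ 𝔒`. Here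
`Tr (χ_x P_J)` is the trace of the non-negative operator `χ_x P_J χ_x`. -/
def WegnerEstimate {Ω : Type*} [MeasurableSpace Ω] (P : Measure Ω) (𝔒 : Set (Set (Fin D → ℝ)))
    (HO : (U : Set (Fin D → ℝ)) → Ω → L2 U →ₗ.[ℂ] L2 U) : Prop :=
  ∀ I : Set ℝ, I.OrdConnected → Bornology.IsBounded I → ∃ C : ℝ, 0 < C ∧
    ∀ x : Fin D → ℝ, ∀ U ∈ 𝔒, ∀ J : Set ℝ, J.OrdConnected → J ⊆ I →
      ∫⁻ ω, posTrace (chi U x ∘L spectralProj (HO U ω) J ∘L chi U x) ∂P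
        ≤ ENNReal.ofReal C * volume J

/-- The Combes–Thomas bound for the operators `HO U`, `U ∈ 𝔒`, with uniform constants. -/
def CombesThomasBound {Ω : Type*} [MeasurableSpace Ω] (P : Measure Ω)
    (𝔒 : Set (Set (Fin D → ℝ))) (d : PseudoMetric (Fin D → ℝ) ℝ)
    (HO : (U : Set (Fin D → ℝ)) → Ω → L2 U →ₗ.[ℂ] L2 U) : Prop :=
  ∃ C₀ μ₀ : ℝ, 0 < C₀ ∧ 0 < μ₀ ∧
    ∀ x y : Fin D → ℝ, ∀ U ∈ 𝔒, ∀ᵐ ω ∂P, ∀ z : ℂ, z ∉ opSpectrum (HO U ω) →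
      ‖chi U x ∘L opResolvent (HO U ω) z ∘L chi U y‖
        ≤ C₀ / Metric.infDist z (opSpectrum (HO U ω)) *
          Real.exp (-μ₀ * Metric.infDist z (opSpectrum (HO U ω)) /
            (1 + ‖z‖ + Metric.infDist z (opSpectrum (HO U ω))) * d x y)

/-- The eigenfunction correlator `∑_{E ∈ σ(T) ∩ I} ‖χ_x P_E(T) χ_y‖`. -/
def eigenfunctionCorrelator {U : Set (Fin D → ℝ)} (T : L2 U →ₗ.[ℂ] L2 U) (I : Set ℝ)
    (x y : Fin D → ℝ) : ℝ≥0∞ :=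
  ∑' E : {E : ℝ // (E : ℂ) ∈ opSpectrum T ∧ E ∈ I}, ‖chi U x ∘L eigenProj T E ∘L chi U y‖ₑ

end Space

end RandomOperator

end

noncomputable section

namespace RandomOperator

/-! ### Bounded functions of a self-adjoint operator with pure point spectrum. -/

section PurePoint

open Filter Topology

variable {E : Type*} [NormedAddCommGroup E] [InnerProductSpace ℂ E]

/-! The resolvent is split into a part controlled by the Combes–Thomas bound and a part carried by
the eigenvalues in `I`. Let z₀ = Re z ± i, on the side of z, so that |z - z₀| ≤ 1, and write R(z) =
∑_{k<n} (z-z₀)^k R(z₀)^{k+1} + (z-z₀)^n R(z₀)^n R(z). The sandwiched powers χ_x R(z₀)^{k+1} χ_y are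
Taylor coefficients of ζ ↦ χ_x R(ζ) χ_y at z₀. Cauchy's estimate on the circle of radius 1/2, where
Combes–Thomas has a fixed rate, bounds the sum by 2^n C exp(-m d(x,y)). The remainder is a function
of the operator: its symbol is at most |a-z|⁻¹ on `I`, and at most (1+δ²)^{-n/2}/δ off `I`, because
Re z has distance at least δ from the complement of `I`. For n a small multiple of d(x,y) both
errors decay exponentially (`enorm_comp_opResolvent_comp_le`, `exists_two_pow_mul_exp_add_pow_le`).

There remains ∑_{E∈I} |E-z|⁻¹ ‖χ_x P_E χ_y‖, whose s-th power is at most the sum of the s-th powers.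
A dyadic decomposition around Re z makes the weight about 2^{ks} on an interval of length about
2^{-k}. So it suffices that 𝔼 ∑_{E∈S} ‖χ_x P_E χ_y‖^s ≤ K |S|^{1-θ} exp(-ν d^γ) with s < 1-θ
(`lintegral_eigenSum_rpow_le`). For exponent 1 in place of s, such a bound is a geometric mean of
the Wegner estimate and the assumed correlator decay. For exponent 1/2 the decay is lost but the
power of |S| survives: ‖χ_x P_E χ_x‖^{1/2} = ‖P_E χ_x‖ ≤ ∑_y ‖χ_y P_E χ_x‖ over lattice cubes, and
the exponent-1 bounds are summable by the condition on d. Interpolation between the two covers 1/2 <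
s < 1; smaller s follow from larger ones (`lintegral_rpow_le_of_le`).

Expectations are integrals of [0,∞]-valued functions. Comparing them needs no measurability, but
splitting sums does. Sums over random eigenvalues are therefore shown to be measurable
(`measurable_eigenSum`), starting from the resolvents alone. -/

theorem mem_eigenspace_iff {T : E →ₗ.[ℂ] E} {a : ℝ} {v : E} :
    v ∈ eigenspace T a ↔ ∃ h : v ∈ T.domain, T ⟨v, h⟩ = (a : ℂ) • v := by
  simp only [eigenspace, Submodule.mem_map, LinearMap.mem_ker]
  constructor
  · rintro ⟨⟨w, hw⟩, h, rfl⟩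
    exact ⟨hw, sub_eq_zero.mp h⟩
  · rintro ⟨h, e⟩
    exact ⟨⟨v, h⟩, sub_eq_zero.mpr e, rfl⟩

/-- `A` acts on the eigenspace of `T` to the eigenvalue `a` as multiplication by `f a`. -/
def IsDiagonal (T : E →ₗ.[ℂ] E) (A : E →L[ℂ] E) (f : ℝ → ℂ) : Prop :=
  ∀ a : ℝ, ∀ v ∈ eigenspace T a, A v = f a • v

theorem dense_span_eigenspace {T : E →ₗ.[ℂ] E} (hp : HasPurePointSpectrum T) :
    Dense ((⨆ a : ℝ, eigenspace T a : Submodule ℂ E) : Set E) :=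
  Submodule.dense_iff_topologicalClosure_eq_top.mpr hp

namespace IsDiagonal

variable {T : E →ₗ.[ℂ] E} {A B : E →L[ℂ] E} {f g : ℝ → ℂ}

theorem zero : IsDiagonal T 0 0 := fun a v _ => by simp

theorem one : IsDiagonal T 1 1 := fun a v _ => by simp

theorem add (hA : IsDiagonal T A f) (hB : IsDiagonal T B g) : IsDiagonal T (A + B) (f + g) :=
  fun a v hv => by simp [hA a v hv, hB a v hv, add_smul]

theorem sub (hA : IsDiagonal T A f) (hB : IsDiagonal T B g) : IsDiagonal T (A - B) (f - g) :=
  fun a v hv => by simp [hA a v hv, hB a v hv, sub_smul]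

theorem smul (c : ℂ) (hA : IsDiagonal T A f) : IsDiagonal T (c • A) (c • f) :=
  fun a v hv => by simp [hA a v hv, mul_smul]

theorem mul (hA : IsDiagonal T A f) (hB : IsDiagonal T B g) : IsDiagonal T (A * B) (f * g) :=
  fun a v hv => by simp [hA a v hv, hB a v hv, mul_smul, smul_comm (f a) (g a)]

theorem pow (hA : IsDiagonal T A f) (n : ℕ) : IsDiagonal T (A ^ n) (f ^ n) := by
  induction n with
  | zero => simpa using one
  | succ n ih => simpa only [pow_succ] using ih.mul hA

theorem sum {ι : Type*} (s : Finset ι) {A : ι → E →L[ℂ] E} {f : ι → ℝ → ℂ}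
    (h : ∀ i ∈ s, IsDiagonal T (A i) (f i)) : IsDiagonal T (∑ i ∈ s, A i) (∑ i ∈ s, f i) :=
  fun a v hv => by
    simp only [sum_apply, Finset.sum_apply, Finset.sum_smul]
    exact Finset.sum_congr rfl fun i hi => h i hi a v hv

/-- The eigenvectors span a dense subspace, so an identity between diagonal operators reduces to an
identity between scalar symbols. -/
theorem ext (hp : HasPurePointSpectrum T) (hA : IsDiagonal T A f) (hB : IsDiagonal T B f) :
    A = B := by
  refine ContinuousLinearMap.ext fun u => ?_
  refine (dense_span_eigenspace hp).induction (P := fun u => A u = B u) (fun u hu => ?_)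
    (isClosed_eq A.continuous B.continuous) u
  induction hu using Submodule.iSup_induction' with
  | mem a v hv => rw [hA a v hv, hB a v hv]
  | zero => simp
  | add u v _ _ hu hv => simp [hu, hv]

end IsDiagonal

variable [CompleteSpace E]

theorem inner_apply_left_eq_right {T : E →ₗ.[ℂ] E} (hT : IsSelfAdjoint T) (u v : T.domain) :
    inner ℂ (T u) (v : E) = inner ℂ (u : E) (T v) := by
  have h := LinearPMap.adjoint_isFormalAdjoint hT.dense_domain
  rw [LinearPMap.isSelfAdjoint_def.mp hT] at h
  exact h u v

theorem inner_eigenspace_eq_zero {T : E →ₗ.[ℂ] E} (hT : IsSelfAdjoint T) {a b : ℝ} (hab : a ≠ b)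
    {u v : E} (hu : u ∈ eigenspace T a) (hv : v ∈ eigenspace T b) : inner ℂ u v = 0 := by
  obtain ⟨hu, eu⟩ := mem_eigenspace_iff.mp hu
  obtain ⟨hv, ev⟩ := mem_eigenspace_iff.mp hv
  have h := inner_apply_left_eq_right hT ⟨u, hu⟩ ⟨v, hv⟩
  rw [eu, ev, inner_smul_left, inner_smul_right, Complex.conj_ofReal] at h
  by_contra h0
  exact hab (by exact_mod_cast mul_right_cancel₀ h0 h)

theorem orthogonalFamily_eigenspace {T : E →ₗ.[ℂ] E} (hT : IsSelfAdjoint T) :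
    OrthogonalFamily ℂ (fun a : ℝ => eigenspace T a) fun a => (eigenspace T a).subtypeₗᵢ :=
  OrthogonalFamily.of_pairwise fun _ _ hab =>
    Submodule.isOrtho_iff_inner_eq.mpr fun _ hu _ hv => inner_eigenspace_eq_zero hT hab hu hv

namespace IsDiagonal

variable {T : E →ₗ.[ℂ] E} {A B : E →L[ℂ] E} {f g : ℝ → ℂ}

/-- Pythagoras on finite sums of orthogonal eigenvectors, then density. -/
theorem norm_le (hT : IsSelfAdjoint T) (hp : HasPurePointSpectrum T) (hA : IsDiagonal T A f)
    {c : ℝ} (hc : 0 ≤ c) (hf : ∀ a, ‖f a‖ ≤ c) : ‖A‖ ≤ c := by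
  refine A.opNorm_le_bound hc fun u => ?_
  refine (dense_span_eigenspace hp).induction (P := fun u => ‖A u‖ ≤ c * ‖u‖) (fun u hu => ?_)
    (isClosed_le (by fun_prop) (by fun_prop)) u
  classical
  obtain ⟨l, rfl⟩ := (Submodule.mem_iSup_iff_exists_dfinsupp' _ _).mp hu
  have h1 := (orthogonalFamily_eigenspace hT).norm_sum (fun a => l a) l.support
  have h2 := (orthogonalFamily_eigenspace hT).norm_sum (fun a => f a • l a) l.support
  simp only [Submodule.coe_subtypeₗᵢ, Submodule.subtype_apply] at h1 h2
  have e1 : (l.sum fun a v => (v : E)) = ∑ a ∈ l.support, ((l a : eigenspace T a) : E) := rfl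
  have e2 : A (l.sum fun a v => (v : E))
      = ∑ a ∈ l.support, ((f a • l a : eigenspace T a) : E) := by
    rw [e1, map_sum]
    exact Finset.sum_congr rfl fun a _ => hA a _ (l a).2
  refine le_of_sq_le_sq ?_ (by positivity)
  rw [e2, h2, e1, mul_pow, h1, Finset.mul_sum]
  refine Finset.sum_le_sum fun a _ => ?_
  rw [norm_smul, mul_pow]
  gcongr
  exact hf a

/-- Convergence is clear on eigenvectors; the uniform bound on the norms carries it to the closure
of their span. In general it is only strong convergence. -/
theorem tendsto {ι : Type*} {l : Filter ι} (hT : IsSelfAdjoint T) (hp : HasPurePointSpectrum T)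
    {A : ι → E →L[ℂ] E} {f : ι → ℝ → ℂ} {B : E →L[ℂ] E} {g : ℝ → ℂ}
    (hA : ∀ i, IsDiagonal T (A i) (f i)) (hB : IsDiagonal T B g) {c : ℝ} (hc : 0 ≤ c)
    (hf : ∀ i a, ‖f i a‖ ≤ c) (hfg : ∀ a, Tendsto (fun i => f i a) l (𝓝 (g a))) (u : E) :
    Tendsto (fun i => A i u) l (𝓝 (B u)) := by
  have key : ∀ v ∈ (⨆ a : ℝ, eigenspace T a : Submodule ℂ E),
      Tendsto (fun i => A i v) l (𝓝 (B v)) := by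
    intro v hv
    induction hv using Submodule.iSup_induction' with
    | mem a v hv => simpa only [hB a v hv, hA _ a v hv] using (hfg a).smul_const v
    | zero => simpa using tendsto_const_nhds
    | add u v _ _ hu hv => simpa using hu.add hv
  have hAn : ∀ i, ‖A i‖ ≤ c := fun i => (hA i).norm_le hT hp hc (hf i)
  rw [Metric.tendsto_nhds]
  intro ε hε
  have hM : 0 < c + ‖B‖ + 1 := by positivity
  obtain ⟨v, hv, huv⟩ := (dense_span_eigenspace hp).exists_dist_lt u
    (ε := ε / 2 / (c + ‖B‖ + 1)) (by positivity)
  filter_upwards [Metric.tendsto_nhds.mp (key v hv) (ε / 2) (by positivity)] with i hi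
  rw [dist_eq_norm] at huv hi ⊢
  have e : A i u - B u = A i (u - v) + (A i v - B v) - B (u - v) := by simp only [map_sub]; abel
  have h1 : ‖A i (u - v)‖ ≤ c * ‖u - v‖ := (A i).le_of_opNorm_le (hAn i) _
  have h2 : ‖B (u - v)‖ ≤ ‖B‖ * ‖u - v‖ := B.le_opNorm _
  rw [lt_div_iff₀ hM] at huv
  calc ‖A i u - B u‖ ≤ ‖A i (u - v)‖ + ‖A i v - B v‖ + ‖B (u - v)‖ := by
        rw [e]; exact (norm_sub_le _ _).trans (by gcongr; exact norm_add_le _ _)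
    _ < ε := by nlinarith [norm_nonneg (u - v)]

end IsDiagonal

theorem isDiagonal_spectralProj {T : E →ₗ.[ℂ] E} (hT : IsSelfAdjoint T) (S : Set ℝ) :
    IsDiagonal T (spectralProj T S) (S.indicator 1) := by
  intro a v hv
  by_cases ha : a ∈ S
  · rw [Set.indicator_of_mem ha, Pi.one_apply, one_smul]
    refine Submodule.starProjection_eq_self_iff.mpr (Submodule.le_topologicalClosure _ ?_)
    exact Submodule.mem_iSup_of_mem a (Submodule.mem_iSup_of_mem ha hv)
  · rw [Set.indicator_of_notMem ha, zero_smul]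
    refine (Submodule.starProjection_apply_eq_zero_iff _).mpr ?_
    rw [Submodule.orthogonal_closure]
    refine (Submodule.mem_orthogonal _ _).mpr fun u hu => ?_
    induction hu using Submodule.iSup_induction' with
    | mem b u hu =>
      by_cases hb : b ∈ S
      · simp only [hb, iSup_pos] at hu
        exact inner_eigenspace_eq_zero hT (fun h : b = a => ha (h ▸ hb)) hu hv
      · simp only [hb, iSup_neg, not_false_eq_true, Submodule.mem_bot] at hu
        simp [hu]
    | zero => simp
    | add u w _ _ hu hw => rw [inner_add_left, hu, hw, add_zero]

theorem isDiagonal_eigenProj {T : E →ₗ.[ℂ] E} (hT : IsSelfAdjoint T) (a : ℝ) :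
    IsDiagonal T (eigenProj T a) (({a} : Set ℝ).indicator 1) :=
  isDiagonal_spectralProj hT {a}

theorem inner_spectralProj_left (T : E →ₗ.[ℂ] E) (S : Set ℝ) (u v : E) :
    inner ℂ (spectralProj T S u) v = inner ℂ u (spectralProj T S v) :=
  Submodule.inner_starProjection_left_eq_right _ u v

theorem spectralProj_apply_spectralProj (T : E →ₗ.[ℂ] E) (S : Set ℝ) (u : E) :
    spectralProj T S (spectralProj T S u) = spectralProj T S u :=
  Submodule.starProjection_eq_self_iff.mpr (Submodule.starProjection_apply_mem _ u)

/-- A diagonal operator with bounded symbol is the strongly convergent sum of the eigenprojections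
weighted by the symbol. -/
theorem IsDiagonal.hasSum {T : E →ₗ.[ℂ] E} (hT : IsSelfAdjoint T) (hp : HasPurePointSpectrum T)
    {A : E →L[ℂ] E} {f : ℝ → ℂ} (hA : IsDiagonal T A f) {c : ℝ} (hf : ∀ a, ‖f a‖ ≤ c) (u : E) :
    HasSum (fun a : ℝ => f a • eigenProj T a u) (A u) := by
  classical
  have hc : 0 ≤ c := (norm_nonneg _).trans (hf 0)
  have hd : ∀ s : Finset ℝ, IsDiagonal T (∑ a ∈ s, f a • eigenProj T a)
      (∑ a ∈ s, f a • ({a} : Set ℝ).indicator 1) := fun s =>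
    IsDiagonal.sum s fun a _ => (isDiagonal_eigenProj hT a).smul (f a)
  have hv : ∀ (s : Finset ℝ) (b : ℝ), (∑ a ∈ s, f a • ({a} : Set ℝ).indicator (1 : ℝ → ℂ)) b
      = if b ∈ s then f b else 0 := fun s b => by
    simp [Finset.sum_apply, Pi.single_apply]
  have := IsDiagonal.tendsto (l := atTop) hT hp hd hA hc (fun s b => by
    rw [hv]; split_ifs; exacts [hf b, by simpa using hc]) (fun b => by
    refine tendsto_const_nhds.congr' ?_
    filter_upwards [eventually_ge_atTop ({b} : Finset ℝ)] with s hs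
    rw [hv, if_pos (hs (Finset.mem_singleton_self b))]) u
  simpa [HasSum, sum_apply] using this

/-- Bessel's inequality. By orthogonality the left side is ‖A u‖², where A is the sum of the
projections, a contraction with A P_S = A. -/
theorem norm_sq_sum_eigenProj {T : E →ₗ.[ℂ] E} (hT : IsSelfAdjoint T) (hp : HasPurePointSpectrum T)
    {S : Set ℝ} (s : Finset ℝ) (hs : ∀ a ∈ s, a ∈ S) (u : E) :
    ∑ a ∈ s, ‖eigenProj T a u‖ ^ 2 ≤ ‖spectralProj T S u‖ ^ 2 := by
  classical
  have hmul : ∀ a b : ℝ, eigenProj T a * eigenProj T b = if a = b then eigenProj T a else 0 := by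
    intro a b
    refine IsDiagonal.ext hp ((isDiagonal_eigenProj hT a).mul (isDiagonal_eigenProj hT b))
      (f := _) ?_
    split_ifs with h
    · subst h
      convert isDiagonal_eigenProj hT a using 1
      ext x; by_cases hx : x = a <;> simp [hx]
    · convert IsDiagonal.zero (T := T) using 1
      ext x
      by_cases hx : x = a <;> by_cases hy : x = b <;> simp_all
  set A : E →L[ℂ] E := ∑ a ∈ s, eigenProj T a with hA
  have hAd : IsDiagonal T A (∑ a ∈ s, ({a} : Set ℝ).indicator 1) :=
    IsDiagonal.sum s fun a _ => isDiagonal_eigenProj hT a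
  have hAS : A * spectralProj T S = A := by
    refine IsDiagonal.ext hp (hAd.mul (isDiagonal_spectralProj hT S)) ?_
    convert hAd using 1
    ext x
    by_cases hx : x ∈ S
    · simp [hx]
    · have : ∀ a ∈ s, x ≠ a := fun a ha h => hx (h ▸ hs a ha)
      simp only [Pi.mul_apply, Set.indicator_of_notMem hx, mul_zero, Finset.sum_apply]
      exact (Finset.sum_eq_zero fun a ha => by simp [this a ha]).symm
  have hAn : ‖A‖ ≤ 1 := hAd.norm_le hT hp zero_le_one fun b => by
    have : (∑ a ∈ s, ({a} : Set ℝ).indicator (1 : ℝ → ℂ)) b = if b ∈ s then 1 else 0 := by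
      simp [Finset.sum_apply, Pi.single_apply]
    rw [this]; split_ifs <;> simp
  have hsum : ((∑ a ∈ s, ‖eigenProj T a u‖ ^ 2 : ℝ) : ℂ) = inner ℂ (A u) (A u) := by
    rw [hA, sum_apply, sum_inner]
    push_cast
    refine Finset.sum_congr rfl fun a ha => ?_
    rw [inner_sum, Finset.sum_eq_single a]
    · rw [inner_self_eq_norm_sq_to_K]; simp
    · intro b _ hb
      have := congrArg (fun B : E →L[ℂ] E => B u) (hmul a b)
      simp only [mul_apply_eq_comp, if_neg hb.symm] at this
      rw [eigenProj, inner_spectralProj_left]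
      change inner ℂ u (eigenProj T a (eigenProj T b u)) = 0
      rw [this]; simp
    · intro h; exact absurd ha h
  have h2 : ∑ a ∈ s, ‖eigenProj T a u‖ ^ 2 = ‖A u‖ ^ 2 := by
    rw [inner_self_eq_norm_sq_to_K] at hsum
    exact Complex.ofReal_injective (hsum.trans (Complex.ofReal_pow _ _).symm)
  rw [h2, ← hAS, mul_apply_eq_comp]
  gcongr
  simpa using A.le_of_opNorm_le hAn (spectralProj T S u)

end PurePoint

end RandomOperator

end

noncomputable section

namespace RandomOperator

/-! ### The resolvent: Neumann series, Cauchy's estimate and the splitting at `I`. -/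

section Resolvent

open Filter Topology

variable {E : Type*} [NormedAddCommGroup E] [InnerProductSpace ℂ E]

theorem IsResolventAt.isDiagonal {T : E →ₗ.[ℂ] E} {z : ℂ} {R : E →L[ℂ] E}
    (hR : IsResolventAt T z R) : IsDiagonal T R fun a => ((a : ℂ) - z)⁻¹ := by
  intro a v hv
  obtain ⟨h, e⟩ := mem_eigenspace_iff.mp hv
  have h1 := hR.2 ⟨v, h⟩
  rw [e, ← sub_smul, map_smul] at h1
  by_cases hz : (a : ℂ) - z = 0
  · rw [hz, zero_smul] at h1
    have hv0 : v = 0 := h1.symm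
    simp [hv0]
  · exact (eq_inv_smul_iff₀ hz).mpr h1

theorem isResolventAt_opResolvent {T : E →ₗ.[ℂ] E} {z : ℂ} (hz : z ∉ opSpectrum T) :
    IsResolventAt T z (opResolvent T z) := by
  have h : ∃ R : E →L[ℂ] E, IsResolventAt T z R := not_not.mp hz
  rw [opResolvent, dif_pos h]
  exact h.choose_spec

theorem ofReal_mem_opSpectrum {T : E →ₗ.[ℂ] E} {a : ℝ} {v : E} (hv : v ∈ eigenspace T a)
    (h0 : v ≠ 0) : (a : ℂ) ∈ opSpectrum T := by
  rintro ⟨R, hR⟩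
  obtain ⟨h, e⟩ := mem_eigenspace_iff.mp hv
  have h1 := hR.2 ⟨v, h⟩
  rw [e, sub_self, map_zero] at h1
  exact h0 h1.symm

variable [CompleteSpace E]

theorem abs_im_mul_norm_le {T : E →ₗ.[ℂ] E} (hT : IsSelfAdjoint T) (z : ℂ) (v : T.domain) :
    |z.im| * ‖(v : E)‖ ≤ ‖T v - z • (v : E)‖ := by
  have him : (inner ℂ (v : E) (T v)).im = 0 := by
    have h := congrArg Complex.im (inner_apply_left_eq_right hT v v)
    rw [← inner_conj_symm, Complex.conj_im] at h
    linarith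
  have h1 : (inner ℂ (v : E) (T v - z • (v : E))).im = -z.im * ‖(v : E)‖ ^ 2 := by
    rw [inner_sub_right, inner_smul_right, inner_self_eq_norm_sq_to_K, Complex.sub_im, him]
    have : (((‖(v : E)‖ : ℝ) : ℂ) ^ 2) = ((‖(v : E)‖ ^ 2 : ℝ) : ℂ) := by push_cast; rfl
    change 0 - (z * ((‖(v : E)‖ : ℝ) : ℂ) ^ 2).im = _
    rw [this, Complex.im_mul_ofReal]; ring
  have h2 : |z.im| * ‖(v : E)‖ ^ 2 ≤ ‖(v : E)‖ * ‖T v - z • (v : E)‖ := by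
    calc |z.im| * ‖(v : E)‖ ^ 2 = |(inner ℂ (v : E) (T v - z • (v : E))).im| := by
          rw [h1, abs_mul, abs_neg, abs_of_nonneg (sq_nonneg ‖(v : E)‖)]
      _ ≤ _ := (Complex.abs_im_le_norm _).trans (norm_inner_le_norm _ _)
  rcases (norm_nonneg (v : E)).eq_or_lt with h | h
  · rw [← h, mul_zero]; exact norm_nonneg _
  · refine le_of_mul_le_mul_left ?_ h
    linarith

/-- The range of T - z contains all eigenvectors, hence is dense; it is closed because T is closed
and T - z is bounded below by |Im z|. -/
theorem exists_apply_sub_smul_eq {T : E →ₗ.[ℂ] E} (hT : IsSelfAdjoint T)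
    (hp : HasPurePointSpectrum T) {z : ℂ} (hz : z.im ≠ 0) (u : E) :
    ∃ v : T.domain, T v - z • (v : E) = u := by
  set L : T.domain →ₗ[ℂ] E := T.toFun - z • T.domain.subtype with hL
  have hLv : ∀ v : T.domain, L v = T v - z • (v : E) := fun v => rfl
  have hbound : ∀ v : T.domain, |z.im| * ‖(v : E)‖ ≤ ‖L v‖ := abs_im_mul_norm_le hT z
  have hpos : 0 < |z.im| := abs_pos.mpr hz
  have hspan : (⨆ a : ℝ, eigenspace T a) ≤ LinearMap.range L := by
    refine iSup_le fun a v hv => ?_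
    obtain ⟨h, e⟩ := mem_eigenspace_iff.mp hv
    have hne : (a : ℂ) - z ≠ 0 := fun h => hz (by simpa using congrArg Complex.im h)
    refine ⟨((a : ℂ) - z)⁻¹ • ⟨v, h⟩, ?_⟩
    rw [map_smul, hLv, e, ← sub_smul, inv_smul_smul₀ hne]
  have hdense : Dense (LinearMap.range L : Set E) :=
    (dense_span_eigenspace hp).mono (by exact_mod_cast hspan)
  obtain ⟨w, hw, hlim⟩ := mem_closure_iff_seq_limit.mp (hdense u)
  choose v hv using hw
  have hcauchy : CauchySeq fun n => (v n : E) := by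
    refine Metric.cauchySeq_iff.mpr fun ε hε => ?_
    obtain ⟨N, hN⟩ := Metric.cauchySeq_iff.mp hlim.cauchySeq (|z.im| * ε) (by positivity)
    refine ⟨N, fun m hm n hn => ?_⟩
    have h1 := hN m hm n hn
    rw [dist_eq_norm, ← hv, ← hv, ← map_sub] at h1
    have h2 := (hbound (v m - v n)).trans_lt h1
    rw [dist_eq_norm]
    exact lt_of_mul_lt_mul_left h2 hpos.le
  obtain ⟨x, hx⟩ := cauchySeq_tendsto_of_complete hcauchy
  have hTv : Tendsto (fun n => T (v n)) atTop (𝓝 (u + z • x)) := by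
    refine (hlim.add (hx.const_smul z)).congr fun n => ?_
    rw [← hv, hLv, sub_add_cancel]
  have hmem : (x, u + z • x) ∈ T.graph := by
    refine (IsClosed.mem_of_tendsto (b := atTop) hT.isClosed (hx.prodMk_nhds hTv)
      (Eventually.of_forall fun n => ?_))
    exact LinearPMap.mem_graph T (v n)
  obtain ⟨y, hy, hy'⟩ := (LinearPMap.mem_graph_iff T).mp hmem
  refine ⟨y, ?_⟩
  rw [hy', hy]
  simp

theorem notMem_opSpectrum {T : E →ₗ.[ℂ] E} (hT : IsSelfAdjoint T)
    (hp : HasPurePointSpectrum T) {z : ℂ} (hz : z.im ≠ 0) : z ∉ opSpectrum T := by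
  refine not_not.mpr ?_
  have hpos : 0 < |z.im| := abs_pos.mpr hz
  choose S hS using exists_apply_sub_smul_eq hT hp hz
  have hinj : ∀ v w : T.domain, T v - z • (v : E) = T w - z • (w : E) → v = w := by
    intro v w h
    have h1 := abs_im_mul_norm_le hT z (v - w)
    have h2 : T (v - w) - z • ((v - w : T.domain) : E) = 0 := by
      rw [T.map_sub, Submodule.coe_sub, smul_sub, sub_sub_sub_comm, h, sub_self]
    rw [h2, norm_zero] at h1
    have h3 : ‖((v - w : T.domain) : E)‖ = 0 :=
      le_antisymm (nonpos_of_mul_nonpos_right h1 hpos) (norm_nonneg _)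
    exact sub_eq_zero.mp (Subtype.ext (norm_eq_zero.mp h3))
  refine ⟨LinearMap.mkContinuous
    { toFun := fun u => (S u : E)
      map_add' := fun u w => ?_
      map_smul' := fun c u => ?_ } |z.im|⁻¹ fun u => ?_, fun u => ⟨(S u).2, hS u⟩, fun v => ?_⟩
  · rw [← Submodule.coe_add]
    refine congrArg _ (hinj _ _ ?_)
    rw [hS, T.map_add, Submodule.coe_add, smul_add, add_sub_add_comm, hS, hS]
  · rw [RingHom.id_apply, ← Submodule.coe_smul]
    refine congrArg _ (hinj _ _ ?_)
    rw [hS, T.map_smul, Submodule.coe_smul, smul_comm z c, ← smul_sub, hS]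
  · have := abs_im_mul_norm_le hT z (S u)
    rw [hS] at this
    change ‖(S u : E)‖ ≤ _
    rwa [inv_mul_eq_div, le_div_iff₀' hpos]
  · change ((S _ : T.domain) : E) = v
    exact congrArg _ (hinj _ _ (hS _))

theorem im_eq_zero_of_mem_opSpectrum {T : E →ₗ.[ℂ] E} (hT : IsSelfAdjoint T)
    (hp : HasPurePointSpectrum T) {z : ℂ} (hz : z ∈ opSpectrum T) : z.im = 0 :=
  by_contra fun h => notMem_opSpectrum hT hp h hz

theorem abs_im_le_infDist_opSpectrum {T : E →ₗ.[ℂ] E} (hT : IsSelfAdjoint T)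
    (hp : HasPurePointSpectrum T) (hne : (opSpectrum T).Nonempty) (z : ℂ) :
    |z.im| ≤ Metric.infDist z (opSpectrum T) := by
  refine (Metric.le_infDist hne).mpr fun w hw => ?_
  rw [dist_eq_norm]
  refine le_trans (le_of_eq ?_) (Complex.abs_im_le_norm _)
  rw [Complex.sub_im, im_eq_zero_of_mem_opSpectrum hT hp hw, sub_zero]

theorem isDiagonal_opResolvent {T : E →ₗ.[ℂ] E} (hT : IsSelfAdjoint T)
    (hp : HasPurePointSpectrum T) {z : ℂ} (hz : z.im ≠ 0) :
    IsDiagonal T (opResolvent T z) fun a => ((a : ℂ) - z)⁻¹ :=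
  (isResolventAt_opResolvent (notMem_opSpectrum hT hp hz)).isDiagonal

theorem abs_im_le_norm_ofReal_sub (a : ℝ) (z : ℂ) : |z.im| ≤ ‖(a : ℂ) - z‖ := by
  simpa using Complex.abs_im_le_norm ((a : ℂ) - z)

theorem ofReal_sub_ne_zero {z : ℂ} (hz : z.im ≠ 0) (a : ℝ) : (a : ℂ) - z ≠ 0 :=
  norm_pos_iff.mp ((abs_pos.mpr hz).trans_le (abs_im_le_norm_ofReal_sub a z))

theorem norm_opResolvent_le {T : E →ₗ.[ℂ] E} (hT : IsSelfAdjoint T)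
    (hp : HasPurePointSpectrum T) {z : ℂ} (hz : z.im ≠ 0) : ‖opResolvent T z‖ ≤ |z.im|⁻¹ := by
  refine (isDiagonal_opResolvent hT hp hz).norm_le hT hp (by positivity) fun a => ?_
  rw [norm_inv]
  exact inv_anti₀ (abs_pos.mpr hz) (abs_im_le_norm_ofReal_sub a z)

/-- The truncated Neumann series of the resolvent. -/
theorem opResolvent_eq_sum_add {T : E →ₗ.[ℂ] E} (hT : IsSelfAdjoint T)
    (hp : HasPurePointSpectrum T) {z₀ z : ℂ} (hz₀ : z₀.im ≠ 0) (hz : z.im ≠ 0) (n : ℕ) :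
    opResolvent T z = ∑ k ∈ Finset.range n, (z - z₀) ^ k • opResolvent T z₀ ^ (k + 1)
      + (z - z₀) ^ n • (opResolvent T z₀ ^ n * opResolvent T z) := by
  have h0 := isDiagonal_opResolvent hT hp hz₀
  have h1 := isDiagonal_opResolvent hT hp hz
  refine IsDiagonal.ext hp h1 ?_
  convert (IsDiagonal.sum (Finset.range n) fun k _ => (h0.pow (k + 1)).smul ((z - z₀) ^ k)).add
    (((h0.pow n).mul h1).smul ((z - z₀) ^ n)) using 1
  ext a
  have ha0 := ofReal_sub_ne_zero hz₀ a
  have ha := ofReal_sub_ne_zero hz a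
  simp only [Pi.add_apply, Finset.sum_apply, Pi.smul_apply, Pi.pow_apply, Pi.mul_apply,
    smul_eq_mul]
  have key : ((a : ℂ) - z)⁻¹ = ((a : ℂ) - z₀)⁻¹
      + (z - z₀) * ((a : ℂ) - z₀)⁻¹ * ((a : ℂ) - z)⁻¹ := by
    field_simp
    ring
  generalize ((a : ℂ) - z)⁻¹ = q at key ⊢
  generalize ((a : ℂ) - z₀)⁻¹ = p at key ⊢
  induction n with
  | zero => simp
  | succ n ih =>
    rw [Finset.sum_range_succ]
    linear_combination ih + (z - z₀) ^ n * p ^ n * key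

/-- The exact remainder of the truncated series tends to zero geometrically, since ‖w‖ ‖R(z₀)‖ < 1.
-/
theorem hasSum_opResolvent {T : E →ₗ.[ℂ] E} (hT : IsSelfAdjoint T)
    (hp : HasPurePointSpectrum T) {z₀ w : ℂ} (hz₀ : z₀.im ≠ 0) (hw : ‖w‖ < |z₀.im|) :
    HasSum (fun n => w ^ n • opResolvent T z₀ ^ (n + 1)) (opResolvent T (z₀ + w)) := by
  have hpos : 0 < |z₀.im| := abs_pos.mpr hz₀
  have hz : (z₀ + w).im ≠ 0 := fun h => by
    rw [Complex.add_im] at h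
    have := Complex.abs_im_le_norm w
    rw [show w.im = -z₀.im by linarith, abs_neg] at this
    linarith
  have hlt : ‖w‖ * ‖opResolvent T z₀‖ < 1 := by
    calc ‖w‖ * ‖opResolvent T z₀‖ ≤ ‖w‖ * |z₀.im|⁻¹ := by
          gcongr; exact norm_opResolvent_le hT hp hz₀
      _ < 1 := by rwa [← div_eq_mul_inv, div_lt_one hpos]
  have hgeo := summable_geometric_of_lt_one (by positivity) hlt
  have hpow : ∀ n, ‖opResolvent T z₀ ^ n‖ ≤ ‖opResolvent T z₀‖ ^ n := fun n => by
    -- In the trivial space the identity has norm 0, so the zeroth power only satisfies ‖1‖ ≤ 1.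
    rcases n with _ | n
    · rw [pow_zero, pow_zero]
      exact ContinuousLinearMap.norm_id_le
    · exact norm_pow_le' _ n.succ_pos
  have hsum : Summable fun n => w ^ n • opResolvent T z₀ ^ (n + 1) := by
    refine Summable.of_norm_bounded (hgeo.mul_right ‖opResolvent T z₀‖) fun n => ?_
    rw [norm_smul, norm_pow, mul_pow, mul_assoc, ← pow_succ]
    gcongr
    exact hpow _
  rw [hsum.hasSum_iff_tendsto_nat]
  have hrem : Tendsto (fun n => w ^ n • (opResolvent T z₀ ^ n * opResolvent T (z₀ + w))) atTop
      (𝓝 0) := by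
    refine squeeze_zero_norm (fun n => ?_) (by
      simpa using hgeo.tendsto_atTop_zero.mul_const ‖opResolvent T (z₀ + w)‖)
    rw [norm_smul, norm_pow, mul_pow, mul_assoc]
    gcongr
    refine (norm_mul_le _ _).trans ?_
    gcongr
    exact hpow n
  have h := (tendsto_const_nhds (x := opResolvent T (z₀ + w))).sub hrem
  rw [sub_zero] at h
  refine h.congr fun n => ?_
  have := opResolvent_eq_sum_add hT hp hz₀ hz n
  rw [add_sub_cancel_left] at this
  exact sub_eq_of_eq_add this

/-- The formal power series with given coefficients. -/
def powerSeriesOfCoeff {F : Type*} [NormedAddCommGroup F] [NormedSpace ℂ F] (c : ℕ → F) :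
    FormalMultilinearSeries ℂ ℂ F :=
  fun n => ContinuousMultilinearMap.mkPiRing ℂ (Fin n) (c n)

theorem coeff_powerSeriesOfCoeff {F : Type*} [NormedAddCommGroup F] [NormedSpace ℂ F] (c : ℕ → F)
    (n : ℕ) : (powerSeriesOfCoeff c).coeff n = c n := by
  simp [powerSeriesOfCoeff, FormalMultilinearSeries.coeff, ContinuousMultilinearMap.mkPiRing_apply]

/-- The map `L` will be the sandwich by χ_x and χ_y. It is applied before any norm is taken, since
only the sandwiched resolvents decay in d(x,y). -/
theorem hasFPowerSeriesAt_opResolvent {T : E →ₗ.[ℂ] E} (hT : IsSelfAdjoint T)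
    (hp : HasPurePointSpectrum T) {F : Type*} [NormedAddCommGroup F] [NormedSpace ℂ F]
    (L : (E →L[ℂ] E) →L[ℂ] F) {z₀ : ℂ} (hz₀ : z₀.im ≠ 0) :
    HasFPowerSeriesAt (fun z => L (opResolvent T z))
      (powerSeriesOfCoeff fun n => L (opResolvent T z₀ ^ (n + 1))) z₀ := by
  refine hasFPowerSeriesAt_iff.mpr ?_
  filter_upwards [Metric.ball_mem_nhds (0 : ℂ) (abs_pos.mpr hz₀)] with w hw
  have := (hasSum_opResolvent hT hp hz₀ (mem_ball_zero_iff.mp hw)).mapL L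
  simpa only [coeff_powerSeriesOfCoeff, map_smul] using this

/-- Cauchy's estimate for the powers of the resolvent. -/
theorem norm_opResolvent_pow_le_of_sphere {T : E →ₗ.[ℂ] E} (hT : IsSelfAdjoint T)
    (hp : HasPurePointSpectrum T) {F : Type*} [NormedAddCommGroup F] [NormedSpace ℂ F]
    [CompleteSpace F] (L : (E →L[ℂ] E) →L[ℂ] F) {z₀ : ℂ} {r M : ℝ} (hr : 0 < r)
    (hrz : r < |z₀.im|) (hM : ∀ z, ‖z - z₀‖ = r → ‖L (opResolvent T z)‖ ≤ M) (n : ℕ) :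
    ‖L (opResolvent T z₀ ^ (n + 1))‖ ≤ M * r⁻¹ ^ n := by
  have hz₀ : z₀.im ≠ 0 := abs_pos.mp (hr.trans hrz)
  lift r to NNReal using hr.le
  have hdiff : DifferentiableOn ℂ (fun z => L (opResolvent T z)) (Metric.closedBall z₀ r) := by
    intro z hz
    have hz' : z.im ≠ 0 := fun h => by
      have h1 := Complex.abs_im_le_norm (z - z₀)
      rw [Complex.sub_im, h, zero_sub, abs_neg] at h1
      have h2 := mem_closedBall_iff_norm.mp hz
      linarith
    exact (hasFPowerSeriesAt_opResolvent hT hp L hz').differentiableAt.differentiableWithinAt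
  -- Power series are unique, so the Cauchy coefficients at z₀ are the images under `L` of the
  -- powers of the resolvent.
  have heq := (hdiff.hasFPowerSeriesOnBall (by exact_mod_cast hr)).hasFPowerSeriesAt
    |>.eq_formalMultilinearSeries (hasFPowerSeriesAt_opResolvent hT hp L hz₀)
  have h := norm_cauchyPowerSeries_le (fun z => L (opResolvent T z)) z₀ r n
  rw [heq, FormalMultilinearSeries.norm_apply_eq_norm_coef, coeff_powerSeriesOfCoeff,
    abs_of_pos hr] at h
  refine h.trans ?_
  gcongr
  have hint : ∫ θ in (0 : ℝ)..2 * Real.pi, ‖L (opResolvent T (circleMap z₀ r θ))‖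
      ≤ M * |2 * Real.pi - 0| := by
    refine (le_abs_self _).trans ?_
    rw [← Real.norm_eq_abs]
    refine intervalIntegral.norm_integral_le_of_norm_le_const fun θ _ => ?_
    rw [norm_norm]
    exact hM _ (by simp [circleMap])
  rw [sub_zero, abs_of_pos Real.two_pi_pos] at hint
  rw [inv_mul_le_iff₀ Real.two_pi_pos]
  linarith

/-- The norm of a sandwiched diagonal operator is controlled by the eigenprojections for the
eigenvalues in `I` and by the size of the symbol off `I`. -/
theorem IsDiagonal.enorm_comp_comp_le {T : E →ₗ.[ℂ] E} (hT : IsSelfAdjoint T)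
    (hp : HasPurePointSpectrum T) {A X Y : E →L[ℂ] E} {f : ℝ → ℂ} (hA : IsDiagonal T A f)
    (hX : ‖X‖ ≤ 1) (hY : ‖Y‖ ≤ 1) {I : Set ℝ} {C c : ℝ} (hC : ∀ a, ‖f a‖ ≤ C) (hc : 0 ≤ c)
    (hfc : ∀ a ∉ I, ‖f a‖ ≤ c) :
    ‖X ∘L A ∘L Y‖ₑ ≤ ∑' a : ℝ, I.indicator (fun a => ‖f a‖ₑ * ‖X ∘L eigenProj T a ∘L Y‖ₑ) a
      + ENNReal.ofReal c := by
  have hC0 : 0 ≤ C := (norm_nonneg _).trans (hC 0)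
  -- A P_I is expanded into eigenprojections; A - A P_I has symbol f off `I` and 0 on `I`, and is
  -- bounded in norm.
  have h1 : IsDiagonal T (A * spectralProj T I) (f * I.indicator 1) :=
    hA.mul (isDiagonal_spectralProj hT I)
  have h1n : ∀ a, ‖(f * I.indicator 1 : ℝ → ℂ) a‖ ≤ C := fun a => by
    by_cases ha : a ∈ I <;> simp [ha, hC a, hC0]
  have h2 : ‖A - A * spectralProj T I‖ ≤ c := by
    refine (hA.sub h1).norm_le hT hp hc fun a => ?_
    by_cases ha : a ∈ I
    · simp [ha, hc]
    · simpa [ha] using hfc a ha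
  have e : X ∘L A ∘L Y = X ∘L (A * spectralProj T I) ∘L Y
      + X ∘L (A - A * spectralProj T I) ∘L Y := by
    ext u; simp
  rw [e]
  refine (enorm_add_le _ _).trans (add_le_add ?_ ?_)
  · refine ContinuousLinearMap.opENorm_le_bound _ fun u => ?_
    have hs := (h1.hasSum hT hp h1n (Y u)).mapL X
    change ‖X ((A * spectralProj T I) (Y u))‖ₑ ≤ _
    rw [← hs.tsum_eq, ← ENNReal.tsum_mul_right]
    refine enorm_tsum_le_tsum_enorm.trans (ENNReal.tsum_le_tsum fun a => ?_)
    by_cases ha : a ∈ I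
    · simp only [map_smul, Pi.mul_apply, Set.indicator_of_mem ha, Pi.one_apply, mul_one,
        enorm_smul, mul_assoc]
      gcongr
      exact (X ∘L eigenProj T a ∘L Y).le_opENorm u
    · simp [ha]
  · rw [← ofReal_norm]
    refine ENNReal.ofReal_le_ofReal ?_
    calc ‖X ∘L (A - A * spectralProj T I) ∘L Y‖
        ≤ ‖X‖ * (‖A - A * spectralProj T I‖ * ‖Y‖) :=
          (ContinuousLinearMap.opNorm_comp_le _ _).trans
            (by gcongr; exact ContinuousLinearMap.opNorm_comp_le _ _)
      _ ≤ 1 * (c * 1) := by gcongr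
      _ = c := by ring

/-- A sandwiched resolvent is bounded by the eigenfunctions with energies in `I`, the distance of
the energy to the complement of `I`, and a bound on the sandwiched resolvents far from the real
axis. -/
theorem enorm_comp_opResolvent_comp_le {T : E →ₗ.[ℂ] E} (hT : IsSelfAdjoint T)
    (hp : HasPurePointSpectrum T) {X Y : E →L[ℂ] E} (hX : ‖X‖ ≤ 1) (hY : ‖Y‖ ≤ 1) {I : Set ℝ}
    {z : ℂ} (hz0 : 0 < |z.im|) (hz1 : |z.im| < 1) {δ : ℝ} (hδ : 0 < δ)
    (hI : ∀ a ∉ I, δ ≤ |a - z.re|) {M : ℝ}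
    (hM : ∀ ζ : ℂ, 1 / 2 ≤ |ζ.im| → ‖ζ‖ ≤ |z.re| + 3 / 2 → ‖X ∘L opResolvent T ζ ∘L Y‖ ≤ M)
    (n : ℕ) :
    ‖X ∘L opResolvent T z ∘L Y‖ₑ
      ≤ ∑' a : ℝ, I.indicator
          (fun a => ‖(a : ℂ) - z‖ₑ⁻¹ * ‖X ∘L eigenProj T a ∘L Y‖ₑ) a
        + ENNReal.ofReal (2 ^ n * M + (√(1 + δ ^ 2))⁻¹ ^ n / δ) := by
  -- σ is the sign of Im z, so z₀ = Re z + iσ has distance 1 from the real axis and 1 - |Im z| from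
  -- z.
  obtain ⟨σ, hσ, hσz⟩ : ∃ σ : ℝ, |σ| = 1 ∧ |z.im - σ| = 1 - |z.im| := by
    rcases le_total 0 z.im with h | h
    · refine ⟨1, abs_one, ?_⟩
      rw [abs_of_nonneg h] at hz1 ⊢
      rw [abs_of_nonpos (by linarith)]; ring
    · refine ⟨-1, by simp, ?_⟩
      rw [abs_of_nonpos h] at hz1 ⊢
      rw [abs_of_nonneg (by linarith)]; ring
  set z₀ : ℂ := ⟨z.re, σ⟩ with hz₀
  have him : |z₀.im| = 1 := hσ
  have him0 : z₀.im ≠ 0 := abs_pos.mp (by rw [him]; exact one_pos)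
  have hzim : z.im ≠ 0 := abs_pos.mp hz0
  have hw : ‖z - z₀‖ ≤ 1 := by
    have : z - z₀ = ((z.im - σ : ℝ) : ℂ) * Complex.I := by
      apply Complex.ext <;> simp [hz₀]
    rw [this, norm_mul, Complex.norm_I, mul_one, Complex.norm_real, Real.norm_eq_abs, hσz]
    linarith
  have hM0 : 0 ≤ M := (norm_nonneg _).trans (hM z₀ (by rw [him]; norm_num) (by
    have := Complex.norm_le_abs_re_add_abs_im z₀
    rw [him] at this
    have h2 : z₀.re = z.re := rfl
    rw [h2] at this
    linarith))
  -- On the circle of radius 1/2 around z₀ one has |Im ζ| ≥ 1/2 and |ζ| ≤ |Re z| + 3/2, which is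
  -- where `hM` applies.
  have hpow : ∀ k, ‖X ∘L (opResolvent T z₀ ^ (k + 1)) ∘L Y‖ ≤ M * 2 ^ k := by
    intro k
    have := norm_opResolvent_pow_le_of_sphere hT hp
      ((ContinuousLinearMap.compL ℂ E E E X).comp ((ContinuousLinearMap.compL ℂ E E E).flip Y))
      (z₀ := z₀) (r := 1 / 2) (M := M) (by norm_num) (by rw [him]; norm_num) (fun ζ hζ => ?_) k
    · simpa using this
    · refine hM ζ ?_ ?_
      · have h1 := Complex.abs_im_le_norm (ζ - z₀)
        rw [hζ, Complex.sub_im] at h1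
        have h2 := abs_sub_abs_le_abs_sub z₀.im ζ.im
        rw [him, abs_sub_comm] at h2
        linarith
      · have h1 := Complex.norm_le_abs_re_add_abs_im z₀
        have h2 : z₀.re = z.re := rfl
        rw [him, h2] at h1
        have h3 := norm_le_norm_add_norm_sub' ζ z₀
        rw [hζ] at h3
        linarith
  set A := (z - z₀) ^ n • (opResolvent T z₀ ^ n * opResolvent T z) with hA
  have hAd := (((isDiagonal_opResolvent hT hp him0).pow n).mul
    (isDiagonal_opResolvent hT hp hzim)).smul ((z - z₀) ^ n)
  rw [← hA] at hAd
  set f : ℝ → ℂ := (z - z₀) ^ n • ((fun a : ℝ => ((a : ℂ) - z₀)⁻¹) ^ n * fun a : ℝ =>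
    ((a : ℂ) - z)⁻¹) with hf
  have hfn : ∀ a : ℝ, ‖f a‖ ≤ ‖(a : ℂ) - z₀‖⁻¹ ^ n * ‖(a : ℂ) - z‖⁻¹ := fun a => by
    simp only [hf, Pi.smul_apply, Pi.mul_apply, Pi.pow_apply, smul_eq_mul, norm_mul, norm_pow,
      norm_inv]
    exact mul_le_of_le_one_left (by positivity) (pow_le_one₀ (norm_nonneg _) hw)
  -- As |a - z₀| ≥ 1 for real a, the remainder is nowhere larger than the resolvent symbol.
  have hfa : ∀ a : ℝ, ‖f a‖ ≤ ‖(a : ℂ) - z‖⁻¹ := fun a => by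
    refine (hfn a).trans (mul_le_of_le_one_left (by positivity) (pow_le_one₀ (by positivity) ?_))
    exact inv_le_one_of_one_le₀ (him ▸ abs_im_le_norm_ofReal_sub a z₀)
  have hmain := hAd.enorm_comp_comp_le hT hp hX hY (I := I) (C := |z.im|⁻¹)
    (c := (√(1 + δ ^ 2))⁻¹ ^ n / δ)
    (fun a => (hfa a).trans (inv_anti₀ hz0 (abs_im_le_norm_ofReal_sub a z)))
    (by positivity) (fun a ha => by
      have h1 := hI a ha
      have h2 : δ ≤ ‖(a : ℂ) - z‖ :=
        h1.trans (by simpa using Complex.abs_re_le_norm ((a : ℂ) - z))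
      -- Off `I`, |a - z₀|² = 1 + (a - Re z)² exceeds 1 by at least δ²; this is the source of the
      -- geometric gain in n.
      have h3 : √(1 + δ ^ 2) ≤ ‖(a : ℂ) - z₀‖ := by
        rw [Complex.norm_eq_sqrt_sq_add_sq]
        refine Real.sqrt_le_sqrt ?_
        have e1 : ((a : ℂ) - z₀).re = a - z.re := by simp [hz₀]
        have e2 : ((a : ℂ) - z₀).im ^ 2 = 1 := by
          rw [← sq_abs]; simp [hz₀, hσ]
        rw [e1, e2, ← sq_abs (a - z.re), add_comm]
        gcongr
      refine (hfn a).trans ?_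
      rw [div_eq_mul_inv]
      gcongr)
  have hsum : ‖X ∘L (∑ k ∈ Finset.range n, (z - z₀) ^ k • opResolvent T z₀ ^ (k + 1)) ∘L Y‖
      ≤ 2 ^ n * M := by
    have e : X ∘L (∑ k ∈ Finset.range n, (z - z₀) ^ k • opResolvent T z₀ ^ (k + 1)) ∘L Y
        = ∑ k ∈ Finset.range n, (z - z₀) ^ k • (X ∘L (opResolvent T z₀ ^ (k + 1)) ∘L Y) := by
      ext u; simp [sum_apply]
    rw [e]
    calc _ ≤ ∑ k ∈ Finset.range n, M * 2 ^ k := by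
          refine norm_sum_le_of_le _ fun k _ => ?_
          rw [norm_smul, norm_pow]
          exact (mul_le_of_le_one_left (norm_nonneg _) (pow_le_one₀ (norm_nonneg _) hw)).trans
            (hpow k)
      _ = M * (2 ^ n - 1) := by
          rw [← Finset.mul_sum]
          congr 1
          have := geom_sum_eq (x := (2 : ℝ)) (by norm_num) n
          rw [this]; norm_num
      _ ≤ 2 ^ n * M := by nlinarith
  rw [opResolvent_eq_sum_add hT hp him0 hzim n, ← hA, ContinuousLinearMap.add_comp,
    ContinuousLinearMap.comp_add]
  refine (enorm_add_le _ _).trans ?_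
  rw [add_comm, ENNReal.ofReal_add (by positivity) (by positivity), add_comm (ENNReal.ofReal _),
    ← add_assoc]
  refine add_le_add (hmain.trans ?_) ?_
  · gcongr with a
    rw [← ofReal_norm, ← ofReal_norm,
      ← ENNReal.ofReal_inv_of_pos (norm_pos_iff.mpr (ofReal_sub_ne_zero hzim a))]
    exact ENNReal.ofReal_le_ofReal (hfa a)
  · rw [← ofReal_norm]
    exact ENNReal.ofReal_le_ofReal hsum

end Resolvent

end RandomOperator

end

noncomputable section

namespace RandomOperator

/-! ### Subadditivity of powers for sums in [0,∞]. -/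

section ExtendedReals

theorem tsum_rpow_le {ι : Type*} (f : ι → ℝ≥0∞) {s : ℝ} (hs0 : 0 < s) (hs1 : s ≤ 1) :
    (∑' i, f i) ^ s ≤ ∑' i, f i ^ s := by
  have h : ∑' i, f i ≤ (∑' i, f i ^ s) ^ s⁻¹ := by
    rw [ENNReal.tsum_eq_iSup_sum]
    refine iSup_le fun t => ?_
    rw [ENNReal.le_rpow_inv_iff hs0]
    refine (Finset.le_sum_of_subadditive (fun x : ℝ≥0∞ => x ^ s) ?_ (fun x y => ?_) t f).trans
      (ENNReal.sum_le_tsum t)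
    · simp [hs0]
    · exact ENNReal.rpow_add_le_add_rpow x y hs0.le hs1
  rwa [ENNReal.le_rpow_inv_iff hs0] at h

theorem tsum_sq_le_sq_tsum {ι : Type*} (f : ι → ℝ≥0∞) : ∑' i, f i ^ 2 ≤ (∑' i, f i) ^ 2 := by
  rw [sq (∑' i, f i), ← ENNReal.tsum_mul_right]
  refine ENNReal.tsum_le_tsum fun i => ?_
  rw [sq]
  gcongr
  exact ENNReal.le_tsum i

end ExtendedReals

/-! ### Sandwiched projections, Hilbert–Schmidt norms and traces. -/

section Sandwich

variable {E : Type*} [NormedAddCommGroup E] [InnerProductSpace ℂ E]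

theorem tsum_enorm_inner_sq {ι : Type*} (b : HilbertBasis ι ℂ E) (u : E) :
    ∑' i, ‖inner ℂ (b i) u‖ₑ ^ 2 = ‖u‖ₑ ^ 2 := by
  have h := b.hasSum_inner_mul_inner u u
  have h2 : HasSum (fun i => ‖inner ℂ (b i) u‖ ^ 2) (‖u‖ ^ 2) := by
    have := h.mapL Complex.reCLM
    convert this using 1
    · ext i
      rw [← inner_conj_symm u (b i), RCLike.conj_mul]
      exact (Complex.ofReal_re _).symm.trans (by simp)
    · rw [inner_self_eq_norm_sq_to_K]
      exact (Complex.ofReal_re _).symm.trans (by simp)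
  rw [← ofReal_norm, ← ENNReal.ofReal_pow (norm_nonneg _), ← h2.tsum_eq,
    ENNReal.ofReal_tsum_of_nonneg (fun i => by positivity) h2.summable]
  refine tsum_congr fun i => ?_
  rw [ENNReal.ofReal_pow (norm_nonneg _), ofReal_norm]

variable [CompleteSpace E]

theorem adjoint_spectralProj (T : E →ₗ.[ℂ] E) (S : Set ℝ) :
    ContinuousLinearMap.adjoint (spectralProj T S) = spectralProj T S :=
  ((ContinuousLinearMap.eq_adjoint_iff _ _).mpr fun u v => inner_spectralProj_left T S u v).symm

theorem enorm_adjoint (A : E →L[ℂ] E) : ‖ContinuousLinearMap.adjoint A‖ₑ = ‖A‖ₑ := by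
  rw [← ofReal_norm, ← ofReal_norm, LinearIsometryEquiv.norm_map]

theorem enorm_comp_spectralProj {X : E →L[ℂ] E} (hX : ContinuousLinearMap.adjoint X = X)
    (T : E →ₗ.[ℂ] E) (S : Set ℝ) : ‖X ∘L spectralProj T S‖ₑ = ‖spectralProj T S ∘L X‖ₑ := by
  rw [← enorm_adjoint, ContinuousLinearMap.adjoint_comp, hX, adjoint_spectralProj]

theorem spectralProj_comp_self (T : E →ₗ.[ℂ] E) (S : Set ℝ) :
    spectralProj T S ∘L spectralProj T S = spectralProj T S :=
  ContinuousLinearMap.ext fun u => spectralProj_apply_spectralProj T S u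

/-- The C*-identity for P X, since X P X = (P X)* (P X). -/
theorem enorm_comp_spectralProj_comp_self {X : E →L[ℂ] E}
    (hX : ContinuousLinearMap.adjoint X = X) (T : E →ₗ.[ℂ] E) (S : Set ℝ) :
    ‖X ∘L spectralProj T S ∘L X‖ₑ = ‖spectralProj T S ∘L X‖ₑ ^ 2 := by
  have h : X ∘L spectralProj T S ∘L X
      = ContinuousLinearMap.adjoint (spectralProj T S ∘L X) ∘L (spectralProj T S ∘L X) := by
    rw [ContinuousLinearMap.adjoint_comp, hX, adjoint_spectralProj,
      ContinuousLinearMap.comp_assoc, ← ContinuousLinearMap.comp_assoc (spectralProj T S),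
      spectralProj_comp_self]
  rw [h, ← ofReal_norm, ContinuousLinearMap.norm_adjoint_comp_self,
    ENNReal.ofReal_mul (norm_nonneg _), ofReal_norm, sq]

/-- From X P Y = (X P)(P Y): a product of two norms is at most the larger of their squares. -/
theorem enorm_comp_spectralProj_comp_le_max {X Y : E →L[ℂ] E}
    (hX : ContinuousLinearMap.adjoint X = X) (hY : ContinuousLinearMap.adjoint Y = Y)
    (T : E →ₗ.[ℂ] E) (S : Set ℝ) :
    ‖X ∘L spectralProj T S ∘L Y‖ₑ
      ≤ max ‖X ∘L spectralProj T S ∘L X‖ₑ ‖Y ∘L spectralProj T S ∘L Y‖ₑ := by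
  have h : X ∘L spectralProj T S ∘L Y = (X ∘L spectralProj T S) ∘L (spectralProj T S ∘L Y) := by
    rw [ContinuousLinearMap.comp_assoc, ← ContinuousLinearMap.comp_assoc (spectralProj T S),
      spectralProj_comp_self]
  rw [enorm_comp_spectralProj_comp_self hX, enorm_comp_spectralProj_comp_self hY, h]
  refine (ContinuousLinearMap.opENorm_comp_le _ _).trans ?_
  rw [enorm_comp_spectralProj hX]
  rcases le_total ‖spectralProj T S ∘L X‖ₑ ‖spectralProj T S ∘L Y‖ₑ with h | h
  · exact le_max_of_le_right (by rw [sq]; gcongr)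
  · exact le_max_of_le_left (by rw [sq]; gcongr)

theorem enorm_sq_le_of_forall {E : Type*} [NormedAddCommGroup E] [InnerProductSpace ℂ E]
    (A : E →L[ℂ] E) {M : ℝ≥0∞} (h : ∀ u, ‖A u‖ₑ ^ 2 ≤ M * ‖u‖ₑ ^ 2) : ‖A‖ₑ ^ 2 ≤ M := by
  have h1 : ‖A‖ₑ ≤ M ^ (1 / 2 : ℝ) := by
    refine ContinuousLinearMap.opENorm_le_bound _ fun u => ?_
    have h2 := ENNReal.rpow_le_rpow (h u) (show (0 : ℝ) ≤ 1 / 2 by norm_num)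
    rw [ENNReal.mul_rpow_of_nonneg _ _ (by norm_num), ← ENNReal.rpow_natCast_mul,
      ← ENNReal.rpow_natCast_mul] at h2
    norm_num at h2
    exact h2
  have h3 := pow_le_pow_left₀ (by positivity) h1 2
  rw [← ENNReal.rpow_mul_natCast] at h3
  norm_num at h3
  exact h3

/-- The operator norm is bounded by the Hilbert–Schmidt norm. -/
theorem enorm_sq_le_tsum {ι : Type*} (b : HilbertBasis ι ℂ E) (A : E →L[ℂ] E) :
    ‖A‖ₑ ^ 2 ≤ ∑' i, ‖A (b i)‖ₑ ^ 2 := by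
  rw [← enorm_adjoint]
  refine enorm_sq_le_of_forall _ fun v => ?_
  rw [← tsum_enorm_inner_sq b, ← ENNReal.tsum_mul_right]
  refine ENNReal.tsum_le_tsum fun i => ?_
  rw [ContinuousLinearMap.adjoint_inner_right, ← mul_pow]
  gcongr
  rw [← ofReal_norm, ← ofReal_norm, ← ofReal_norm, ← ENNReal.ofReal_mul (norm_nonneg _)]
  exact ENNReal.ofReal_le_ofReal (norm_inner_le_norm _ _)

theorem tsum_indicator_enorm_eigenProj_sq_le {T : E →ₗ.[ℂ] E} (hT : IsSelfAdjoint T)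
    (hp : HasPurePointSpectrum T) (S : Set ℝ) (u : E) :
    ∑' a : ℝ, S.indicator (fun a => ‖eigenProj T a u‖ₑ ^ 2) a ≤ ‖spectralProj T S u‖ₑ ^ 2 := by
  classical
  rw [ENNReal.tsum_eq_iSup_sum]
  refine iSup_le fun s => ?_
  simp only [Set.indicator_apply, ← Finset.sum_filter]
  have h := norm_sq_sum_eigenProj hT hp (S := S) (s.filter fun a => a ∈ S)
    (fun a ha => (Finset.mem_filter.mp ha).2) u
  have h2 := ENNReal.ofReal_le_ofReal h
  rw [ENNReal.ofReal_sum_of_nonneg fun _ _ => by positivity] at h2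
  simpa only [ENNReal.ofReal_pow (norm_nonneg _), ofReal_norm] using h2

/-- Each ‖X P_a X‖ = ‖P_a X‖² is at most a squared Hilbert–Schmidt norm. Exchanging the sums and
applying Bessel over a to each basis vector produces the trace. Through this bound the Wegner
estimate controls eigenvalue sums. -/
theorem tsum_indicator_enorm_comp_eigenProj_comp_le_posTrace {T : E →ₗ.[ℂ] E}
    (hT : IsSelfAdjoint T) (hp : HasPurePointSpectrum T) {X : E →L[ℂ] E}
    (hX : ContinuousLinearMap.adjoint X = X) (S : Set ℝ) :
    ∑' a : ℝ, S.indicator (fun a => ‖X ∘L eigenProj T a ∘L X‖ₑ) a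
      ≤ posTrace (X ∘L spectralProj T S ∘L X) := by
  obtain ⟨b, hb⟩ := (exists_hilbertBasis ℂ E).choose_spec
  have h1 : ∀ a, ‖X ∘L eigenProj T a ∘L X‖ₑ ≤ ∑' i, ‖eigenProj T a (X (b i))‖ₑ ^ 2 := fun a => by
    rw [eigenProj, enorm_comp_spectralProj_comp_self hX]
    exact enorm_sq_le_tsum b _
  calc ∑' a : ℝ, S.indicator (fun a => ‖X ∘L eigenProj T a ∘L X‖ₑ) a
      ≤ ∑' a : ℝ, ∑' i, S.indicator (fun a => ‖eigenProj T a (X (b i))‖ₑ ^ 2) a := by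
        refine ENNReal.tsum_le_tsum fun a => ?_
        by_cases ha : a ∈ S
        · simpa [ha] using h1 a
        · simp [ha]
    _ = ∑' i, ∑' a : ℝ, S.indicator (fun a => ‖eigenProj T a (X (b i))‖ₑ ^ 2) a :=
        ENNReal.tsum_comm
    _ ≤ ∑' i, ‖spectralProj T S (X (b i))‖ₑ ^ 2 :=
        ENNReal.tsum_le_tsum fun i => tsum_indicator_enorm_eigenProj_sq_le hT hp S _
    _ = posTrace (X ∘L spectralProj T S ∘L X) := by
        refine tsum_congr fun i => ?_
        rw [← hb, ← ofReal_norm, ← ENNReal.ofReal_pow (norm_nonneg _)]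
        congr 1
        have e : inner ℂ (b i) (X (spectralProj T S (X (b i))))
            = inner ℂ (spectralProj T S (X (b i))) (spectralProj T S (X (b i))) := by
          rw [inner_spectralProj_left, spectralProj_apply_spectralProj,
            ← ContinuousLinearMap.adjoint_inner_left, hX]
        change _ = (inner ℂ (b i) (X (spectralProj T S (X (b i))))).re
        rw [e, inner_self_eq_norm_sq_to_K]
        exact (Complex.ofReal_re _).symm.trans (by simp)

theorem eigenProj_eq_zero_of_notMem {T : E →ₗ.[ℂ] E} {a : ℝ} (ha : (a : ℂ) ∉ opSpectrum T) :
    eigenProj T a = 0 := by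
  have h : eigenspace T a = ⊥ := (Submodule.eq_bot_iff _).mpr fun v hv =>
    by_contra fun h0 => ha (ofReal_mem_opSpectrum hv h0)
  refine ContinuousLinearMap.ext fun u => ?_
  have h2 : ∀ w ∈ (⨆ b ∈ ({a} : Set ℝ), eigenspace T b).topologicalClosure, w = 0 := by
    have h3 : (⨆ b ∈ ({a} : Set ℝ), eigenspace T b) = ⊥ := by simp [h]
    intro w hw
    rw [h3, (Submodule.closed_of_finiteDimensional _).submodule_topologicalClosure_eq] at hw
    exact (Submodule.mem_bot ℂ).mp hw
  exact h2 _ (Submodule.starProjection_apply_mem _ u)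

end Sandwich

/-! ### Multiplication by indicators and coverings. -/

section Multiplication

variable {α : Type*} [MeasurableSpace α] {m : Measure α}

theorem mulIndicator_apply {B : Set α} (hB : MeasurableSet B) (f : Lp ℂ 2 m) :
    mulIndicator m hB f = indicatorLp m hB f := rfl

theorem adjoint_mulIndicator {B : Set α} (hB : MeasurableSet B) :
    ContinuousLinearMap.adjoint (mulIndicator m hB) = mulIndicator m hB := by
  refine ((ContinuousLinearMap.eq_adjoint_iff _ _).mpr fun f g => ?_).symm
  rw [mulIndicator_apply, mulIndicator_apply, L2.inner_def, L2.inner_def]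
  refine integral_congr_ae ?_
  filter_upwards [coeFn_indicatorLp hB f, coeFn_indicatorLp hB g] with x hf hg
  rw [hf, hg]
  by_cases hx : x ∈ B <;> simp [hx]

theorem norm_mulIndicator_le {B : Set α} (hB : MeasurableSet B) : ‖mulIndicator m hB‖ ≤ 1 :=
  LinearMap.mkContinuous_norm_le _ zero_le_one _

theorem enorm_sq_eq_lintegral (f : Lp ℂ 2 m) : ‖f‖ₑ ^ 2 = ∫⁻ x, ‖f x‖ₑ ^ 2 ∂m := by
  have := eLpNorm_nnreal_pow_eq_lintegral (μ := m) (f := (f : α → ℂ)) (p := 2) two_ne_zero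
  rw [Lp.enorm_def]
  simpa using this

theorem enorm_mulIndicator_sq {B : Set α} (hB : MeasurableSet B) (f : Lp ℂ 2 m) :
    ‖mulIndicator m hB f‖ₑ ^ 2 = ∫⁻ x in B, ‖f x‖ₑ ^ 2 ∂m := by
  rw [enorm_sq_eq_lintegral, ← lintegral_indicator hB, mulIndicator_apply]
  refine lintegral_congr_ae ?_
  filter_upwards [coeFn_indicatorLp hB f] with x hx
  rw [hx]
  by_cases h : x ∈ B <;> simp [h]

theorem enorm_sq_le_tsum_mulIndicator {ι : Type*} [Countable ι] {B : ι → Set α}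
    (hB : ∀ i, MeasurableSet (B i)) (hcover : ∀ᵐ x ∂m, x ∈ ⋃ i, B i) (f : Lp ℂ 2 m) :
    ‖f‖ₑ ^ 2 ≤ ∑' i, ‖mulIndicator m (hB i) f‖ₑ ^ 2 := by
  simp only [enorm_mulIndicator_sq]
  refine le_trans ?_ (lintegral_iUnion_le B fun x => ‖f x‖ₑ ^ 2)
  rw [enorm_sq_eq_lintegral, Measure.restrict_eq_self_of_ae_mem hcover]

theorem enorm_mulIndicator_sq_le_tsum {ι : Type*} [Countable ι] {B₀ : Set α} {B : ι → Set α}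
    (hB₀ : MeasurableSet B₀) (hB : ∀ i, MeasurableSet (B i))
    (hcover : ∀ᵐ x ∂m, x ∈ B₀ → x ∈ ⋃ i, B i) (f : Lp ℂ 2 m) :
    ‖mulIndicator m hB₀ f‖ₑ ^ 2 ≤ ∑' i, ‖mulIndicator m (hB i) f‖ₑ ^ 2 := by
  simp only [enorm_mulIndicator_sq]
  refine le_trans ?_ (lintegral_iUnion_le B fun x => ‖f x‖ₑ ^ 2)
  exact lintegral_mono' (Measure.restrict_mono_ae hcover) le_rfl

theorem enorm_sq_comp_le {E : Type*} [NormedAddCommGroup E] [InnerProductSpace ℂ E] {ι : Type*}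
    {X : E →L[ℂ] E} {Y : ι → E →L[ℂ] E} (h : ∀ u, ‖X u‖ₑ ^ 2 ≤ ∑' i, ‖Y i u‖ₑ ^ 2)
    (A : E →L[ℂ] E) : ‖X ∘L A‖ₑ ^ 2 ≤ ∑' i, ‖Y i ∘L A‖ₑ ^ 2 := by
  refine enorm_sq_le_of_forall _ fun v => (h (A v)).trans ?_
  rw [← ENNReal.tsum_mul_right]
  refine ENNReal.tsum_le_tsum fun i => ?_
  rw [← mul_pow]
  gcongr
  exact (Y i ∘L A).le_opENorm v

end Multiplication

/-! ### Lattice cubes and the kernels ‖χ_x P_a χ_y‖. -/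

section Tiling

variable {D : ℕ}

/-- The open unit cubes around lattice points miss only points with a half-integer coordinate, which
form a null set. -/
theorem ae_abs_sub_round_lt (U : Set (Fin D → ℝ)) :
    ∀ᵐ t : Fin D → ℝ ∂volume.restrict U, ∀ i : Fin D, |t i - round (t i)| < 1 / 2 := by
  refine ae_restrict_of_ae ?_
  have h : ∀ (i : Fin D) (k : ℤ), ∀ᵐ t : Fin D → ℝ ∂volume, t i ≠ (k : ℝ) + 1 / 2 := by
    intro i k
    have := Measure.pi_hyperplane (fun _ : Fin D => (volume : Measure ℝ)) i ((k : ℝ) + 1 / 2)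
    rw [ae_iff]
    simpa [volume_pi] using this
  filter_upwards [ae_all_iff.mpr fun i => ae_all_iff.mpr (h i)] with t ht i
  refine lt_of_le_of_ne (abs_sub_round _) fun he => ?_
  rcases abs_eq (by norm_num) |>.mp he with h1 | h1
  · exact ht i (round (t i)) (by linarith)
  · refine ht i (round (t i) - 1) ?_
    push_cast
    linarith

theorem mem_ball_of_forall_abs_lt {x t : Fin D → ℝ} (h : ∀ i, |t i - x i| < 1 / 2) :
    t ∈ Metric.ball x (1 / 2) :=
  (dist_pi_lt_iff (by norm_num)).mpr fun i => by simpa [Real.dist_eq] using h i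

theorem ae_mem_iUnion_ball (U : Set (Fin D → ℝ)) :
    ∀ᵐ t : Fin D → ℝ ∂volume.restrict U,
      t ∈ ⋃ y : Fin D → ℤ, Metric.ball (fun i => (y i : ℝ)) (1 / 2) := by
  filter_upwards [ae_abs_sub_round_lt U] with t ht
  exact Set.mem_iUnion.mpr ⟨fun i => round (t i), mem_ball_of_forall_abs_lt ht⟩

/-- The corners of the unit cell of the lattice that contains `x`. -/
def nearLattice (x : Fin D → ℝ) (e : Fin D → Bool) (i : Fin D) : ℤ :=
  ⌊x i⌋ + if e i then 1 else 0

/-- Up to a null set, any unit cube is covered by 2^D lattice cubes. This moves an arbitrary centre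
x to lattice points, the only centres for which summability of d is assumed. -/
theorem ae_mem_iUnion_ball_nearLattice (U : Set (Fin D → ℝ)) (x : Fin D → ℝ) :
    ∀ᵐ t : Fin D → ℝ ∂volume.restrict U, t ∈ Metric.ball x (1 / 2) →
      t ∈ ⋃ e : Fin D → Bool, Metric.ball (fun i => (nearLattice x e i : ℝ)) (1 / 2) := by
  filter_upwards [ae_abs_sub_round_lt U] with t ht hx
  refine Set.mem_iUnion.mpr ⟨fun i => decide (round (t i) = ⌊x i⌋ + 1),
    mem_ball_of_forall_abs_lt fun i => ?_⟩
  have h1 := (dist_pi_lt_iff (by norm_num)).mp (Metric.mem_ball.mp hx) i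
  rw [Real.dist_eq, abs_lt] at h1
  have h2 := abs_lt.mp (ht i)
  have h3 := Int.floor_le (x i)
  have h4 := Int.lt_floor_add_one (x i)
  have h5 : ⌊x i⌋ - 1 < round (t i) := by
    have : ((⌊x i⌋ - 1 : ℤ) : ℝ) < round (t i) := by push_cast; linarith
    exact_mod_cast this
  have h6 : round (t i) < ⌊x i⌋ + 2 := by
    have : (round (t i) : ℝ) < ((⌊x i⌋ + 2 : ℤ) : ℝ) := by push_cast; linarith
    exact_mod_cast this
  have h7 : nearLattice x (fun i => decide (round (t i) = ⌊x i⌋ + 1)) i = round (t i) := by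
    simp only [nearLattice, decide_eq_true_eq]
    split_ifs with h <;> omega
  rw [h7]
  exact ht i

theorem adjoint_chi (U : Set (Fin D → ℝ)) (x : Fin D → ℝ) :
    ContinuousLinearMap.adjoint (chi U x) = chi U x :=
  adjoint_mulIndicator _

theorem norm_chi_le (U : Set (Fin D → ℝ)) (x : Fin D → ℝ) : ‖chi U x‖ ≤ 1 :=
  norm_mulIndicator_le _

/-- `‖χ_x P_a(T) χ_y‖`. -/
def eigenKernel {U : Set (Fin D → ℝ)} (T : L2 U →ₗ.[ℂ] L2 U) (x y : Fin D → ℝ) (a : ℝ) : ℝ≥0∞ :=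
  ‖chi U x ∘L eigenProj T a ∘L chi U y‖ₑ

variable {U : Set (Fin D → ℝ)}

theorem eigenKernel_le_max (T : L2 U →ₗ.[ℂ] L2 U) (x y : Fin D → ℝ) (a : ℝ) :
    eigenKernel T x y a ≤ max (eigenKernel T x x a) (eigenKernel T y y a) :=
  enorm_comp_spectralProj_comp_le_max (adjoint_chi U x) (adjoint_chi U y) T {a}

/-- The left side equals ‖P_a χ_x‖², and squared norms split over the covering by lattice cubes. -/
theorem eigenKernel_self_le_tsum_sq (T : L2 U →ₗ.[ℂ] L2 U) (x : Fin D → ℝ) (a : ℝ) :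
    eigenKernel T x x a ≤ ∑' y : Fin D → ℤ, eigenKernel T (fun i => (y i : ℝ)) x a ^ 2 := by
  rw [eigenKernel, eigenProj, enorm_comp_spectralProj_comp_self (adjoint_chi U x)]
  have h : ∀ u : L2 U, ‖ContinuousLinearMap.id ℂ (L2 U) u‖ₑ ^ 2
      ≤ ∑' y : Fin D → ℤ, ‖chi U (fun i => (y i : ℝ)) u‖ₑ ^ 2 := fun u =>
    enorm_sq_le_tsum_mulIndicator (fun _ => measurableSet_ball) (ae_mem_iUnion_ball U) u
  have h2 := enorm_sq_comp_le h (spectralProj T {a} ∘L chi U x)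
  rwa [ContinuousLinearMap.id_comp] at h2

theorem eigenKernel_self_le_sum_nearLattice (T : L2 U →ₗ.[ℂ] L2 U) (x : Fin D → ℝ) (a : ℝ) :
    eigenKernel T x x a ≤ ∑' e : Fin D → Bool,
      eigenKernel T (fun i => (nearLattice x e i : ℝ)) (fun i => (nearLattice x e i : ℝ)) a := by
  have h : ∀ x, eigenKernel T x x a = ‖chi U x ∘L eigenProj T a‖ₑ ^ 2 := fun x => by
    rw [eigenKernel, eigenProj, enorm_comp_spectralProj_comp_self (adjoint_chi U x),
      enorm_comp_spectralProj (adjoint_chi U x)]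
  simp only [h]
  exact enorm_sq_comp_le (fun u => enorm_mulIndicator_sq_le_tsum measurableSet_ball
    (fun _ => measurableSet_ball) (ae_mem_iUnion_ball_nearLattice U x) u) _

/-- The diagonal kernel is quadratic in the projection, so its square root is controlled by first
powers of kernels between lattice cubes, whose expectations decay. -/
theorem eigenKernel_self_rpow_half_le (T : L2 U →ₗ.[ℂ] L2 U) (x : Fin D → ℝ) (a : ℝ) :
    eigenKernel T x x a ^ (1 / 2 : ℝ) ≤ ∑' e : Fin D → Bool, ∑' y : Fin D → ℤ,
      eigenKernel T (fun i => (y i : ℝ)) (fun i => (nearLattice x e i : ℝ)) a := by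
  refine (ENNReal.rpow_le_rpow (eigenKernel_self_le_sum_nearLattice T x a) (by norm_num)).trans ?_
  refine (tsum_rpow_le _ (by norm_num) (by norm_num)).trans (ENNReal.tsum_le_tsum fun e => ?_)
  refine (ENNReal.rpow_le_rpow ((eigenKernel_self_le_tsum_sq T _ a).trans
    (tsum_sq_le_sq_tsum _)) (by norm_num)).trans (le_of_eq ?_)
  rw [← ENNReal.rpow_natCast_mul]
  norm_num

/-- `∑_{a ∈ S} ‖χ_x P_a(T) χ_y‖ ^ r`. -/
def eigenSum (T : L2 U →ₗ.[ℂ] L2 U) (S : Set ℝ) (r : ℝ) (x y : Fin D → ℝ) : ℝ≥0∞ :=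
  ∑' a : ℝ, S.indicator (fun a => eigenKernel T x y a ^ r) a

/-- P_a vanishes outside the spectrum, so the index set need not depend on the operator. -/
theorem eigenfunctionCorrelator_eq_eigenSum (T : L2 U →ₗ.[ℂ] L2 U) (S : Set ℝ)
    (x y : Fin D → ℝ) : eigenfunctionCorrelator T S x y = eigenSum T S 1 x y := by
  rw [eigenfunctionCorrelator, eigenSum]
  refine (tsum_subtype {a : ℝ | (a : ℂ) ∈ opSpectrum T ∧ a ∈ S}
    fun a => ‖chi U x ∘L eigenProj T a ∘L chi U y‖ₑ).trans (tsum_congr fun a => ?_)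
  by_cases ha : a ∈ S
  · by_cases ha' : (a : ℂ) ∈ opSpectrum T
    · simp [ha, ha', eigenKernel]
    · have h : eigenKernel T x y a = 0 := by
        rw [eigenKernel, eigenProj_eq_zero_of_notMem ha', ContinuousLinearMap.zero_comp,
          ContinuousLinearMap.comp_zero]
        rw [← ofReal_norm, norm_zero, ENNReal.ofReal_zero]
      simp [ha, ha', h]
  · simp [ha]

theorem eigenSum_mono {T : L2 U →ₗ.[ℂ] L2 U} {S S' : Set ℝ} (h : S ⊆ S') (r : ℝ)
    (x y : Fin D → ℝ) : eigenSum T S r x y ≤ eigenSum T S' r x y :=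
  ENNReal.tsum_le_tsum fun a => Set.indicator_le_indicator_of_subset h (fun _ => zero_le) a

theorem eigenSum_self_le_posTrace {T : L2 U →ₗ.[ℂ] L2 U} (hT : IsSelfAdjoint T)
    (hp : HasPurePointSpectrum T) (S : Set ℝ) (x : Fin D → ℝ) :
    eigenSum T S 1 x x ≤ posTrace (chi U x ∘L spectralProj T S ∘L chi U x) := by
  simpa only [eigenSum, eigenKernel, ENNReal.rpow_one] using
    tsum_indicator_enorm_comp_eigenProj_comp_le_posTrace hT hp (adjoint_chi U x) S

end Tiling

end RandomOperator

end

noncomputable section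

namespace RandomOperator

open Filter Topology

/-! ### Polynomials approximating the indicator of (1/2, 1]. -/

section RealApproximation

/-- With m = n + 1, the product of exponent and base defect is 2^m t^m / m = (2t)^m / m, which tends
to 0 for t ≤ 1/2 and to ∞ for t > 1/2. The divisor m settles the boundary case t = 1/2 and so makes
the limiting set open. -/
theorem tendsto_one_sub_pow_of_le_half {t : ℝ} (ht0 : 0 ≤ t) (ht : t ≤ 1 / 2) :
    Tendsto (fun n : ℕ => 1 - (1 - t ^ (n + 1) / ((n : ℝ) + 1)) ^ 2 ^ (n + 1)) atTop (𝓝 0) := by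
  refine squeeze_zero (fun n => ?_) (fun n => ?_) tendsto_one_div_add_atTop_nhds_zero_nat
  · have h1 : t ^ (n + 1) / ((n : ℝ) + 1) ≤ 1 := by
      rw [div_le_one (by positivity)]
      exact (pow_le_one₀ ht0 (by linarith)).trans (by linarith [n.cast_nonneg (α := ℝ)])
    exact sub_nonneg.mpr (pow_le_one₀ (by linarith) (by
      have : 0 ≤ t ^ (n + 1) / ((n : ℝ) + 1) := by positivity
      linarith))
  · have h1 : t ^ (n + 1) / ((n : ℝ) + 1) ≤ 1 := by
      rw [div_le_one (by positivity)]
      exact (pow_le_one₀ ht0 (by linarith)).trans (by linarith [n.cast_nonneg (α := ℝ)])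
    have h2 := one_add_mul_le_pow (a := -(t ^ (n + 1) / ((n : ℝ) + 1))) (by linarith) (2 ^ (n + 1))
    have h3 : (2 * t) ^ (n + 1) ≤ 1 := pow_le_one₀ (by linarith) (by linarith)
    have h4 : ((2 ^ (n + 1) : ℕ) : ℝ) * (t ^ (n + 1) / ((n : ℝ) + 1))
        = (2 * t) ^ (n + 1) * (1 / ((n : ℝ) + 1)) := by
      push_cast; rw [mul_pow]; ring
    have h5 : (2 * t) ^ (n + 1) * (1 / ((n : ℝ) + 1)) ≤ 1 * (1 / ((n : ℝ) + 1)) := by gcongr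
    rw [← sub_eq_add_neg] at h2
    nlinarith

theorem tendsto_one_sub_pow_of_half_lt {t : ℝ} (ht : 1 / 2 < t) (ht1 : t ≤ 1) :
    Tendsto (fun n : ℕ => 1 - (1 - t ^ (n + 1) / ((n : ℝ) + 1)) ^ 2 ^ (n + 1)) atTop (𝓝 1) := by
  have hlim : Tendsto (fun n : ℕ => (2 * t) ^ (n + 1) / ((n : ℝ) + 1)) atTop atTop := by
    have h := tendsto_pow_const_div_const_pow_of_one_lt 1 (r := 2 * t) (by linarith)
    have h1 : Tendsto (fun n : ℕ => ((n : ℝ) ^ 1 / (2 * t) ^ n)⁻¹) atTop atTop := by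
      refine Tendsto.inv_tendsto_nhdsGT_zero (tendsto_nhdsWithin_iff.mpr ⟨h, ?_⟩)
      filter_upwards [eventually_gt_atTop 0] with n hn
      have : (0 : ℝ) < n := by exact_mod_cast hn
      change (0 : ℝ) < (n : ℝ) ^ 1 / (2 * t) ^ n
      have : 0 < 2 * t := by linarith
      positivity
    refine ((tendsto_add_atTop_iff_nat 1).mpr h1).congr fun n => ?_
    rw [inv_div, pow_one]; push_cast; rfl
  have h0 : Tendsto (fun n : ℕ => (1 - t ^ (n + 1) / ((n : ℝ) + 1)) ^ 2 ^ (n + 1)) atTop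
      (𝓝 0) := by
    refine squeeze_zero (fun n => ?_) (fun n => ?_)
      (Real.tendsto_exp_neg_atTop_nhds_zero.comp hlim)
    · refine pow_nonneg (sub_nonneg.mpr ?_) _
      rw [div_le_one (by positivity)]
      exact (pow_le_one₀ (by linarith) ht1).trans (by linarith [n.cast_nonneg (α := ℝ)])
    · have h1 := Real.one_sub_le_exp_neg (t ^ (n + 1) / ((n : ℝ) + 1))
      have h2 : 0 ≤ 1 - t ^ (n + 1) / ((n : ℝ) + 1) := by
        refine sub_nonneg.mpr ?_
        rw [div_le_one (by positivity)]
        exact (pow_le_one₀ (by linarith) ht1).trans (by linarith [n.cast_nonneg (α := ℝ)])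
      refine (pow_le_pow_left₀ h2 h1 _).trans (le_of_eq ?_)
      rw [← Real.exp_nat_mul, Function.comp_apply]
      congr 1
      push_cast; rw [mul_pow]; ring
  simpa using h0.const_sub 1

end RealApproximation

/-! ### Measurability of spectral projections. -/

section WeakMeasurability

variable {Ω : Type*} [MeasurableSpace Ω]
variable {E : Type*} [NormedAddCommGroup E] [InnerProductSpace ℂ E]

/-- All matrix elements of the random bounded operator `A` are measurable. -/
def WeaklyMeasurable (A : Ω → E →L[ℂ] E) : Prop :=
  ∀ φ ψ : E, Measurable fun ω => inner ℂ φ (A ω ψ)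

theorem HilbertBasis.countable [SecondCountableTopology E] {ι : Type*}
    (b : HilbertBasis ι ℂ E) : Countable ι := by
  refine Pairwise.countable_of_isOpen_disjoint (s := fun i => Metric.ball (b i) (1 / 2))
    (fun i j hij => ?_) (fun i => Metric.isOpen_ball)
    fun i => ⟨b i, Metric.mem_ball_self (by norm_num)⟩
  refine Metric.ball_disjoint_ball ?_
  have h1 : ‖b i - b j‖ ^ 2 = 2 := by
    rw [@norm_sub_sq ℂ, b.orthonormal.2 hij, b.orthonormal.1, b.orthonormal.1]
    norm_num
  rw [dist_eq_norm]
  nlinarith [norm_nonneg (b i - b j)]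

namespace WeaklyMeasurable

variable {A B : Ω → E →L[ℂ] E}

theorem comp_comp [CompleteSpace E] (hA : WeaklyMeasurable A) (X Y : E →L[ℂ] E) :
    WeaklyMeasurable fun ω => X ∘L A ω ∘L Y := fun φ ψ => by
  have h := hA (ContinuousLinearMap.adjoint X φ) (Y ψ)
  simp only [ContinuousLinearMap.adjoint_inner_left] at h
  exact h

/-- By Parseval, a matrix element of the product is a countable sum of products of matrix elements.
-/
theorem mul [CompleteSpace E] [SecondCountableTopology E] (hA : WeaklyMeasurable A)
    (hB : WeaklyMeasurable B) : WeaklyMeasurable fun ω => A ω * B ω := by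
  intro φ ψ
  obtain ⟨w, b, -⟩ := exists_hilbertBasis ℂ E
  have := HilbertBasis.countable b
  have h : ∀ ω, inner ℂ φ ((A ω * B ω) ψ)
      = ∑' i, inner ℂ φ (A ω (b i)) * inner ℂ (b i) (B ω ψ) := fun ω => by
    rw [mul_apply_eq_comp, ← ContinuousLinearMap.adjoint_inner_left,
      ← b.tsum_inner_mul_inner]
    simp only [ContinuousLinearMap.adjoint_inner_left]
  simp only [h]
  exact Measurable.tsum fun i => (hA φ (b i)).mul (hB (b i) ψ)

/-- The bound ‖A‖ ≤ c can be tested on matrix elements between vectors of a countable dense set. -/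
theorem measurable_enorm [SecondCountableTopology E] (hA : WeaklyMeasurable A) :
    Measurable fun ω => ‖A ω‖ₑ := by
  suffices h : Measurable fun ω => ‖A ω‖ by
    simp only [← ofReal_norm]
    exact h.ennreal_ofReal
  refine measurable_of_Iic fun c => ?_
  rcases lt_or_ge c 0 with hc | hc
  · convert MeasurableSet.empty
    ext ω
    simpa using hc.trans_le (norm_nonneg _)
  set e := TopologicalSpace.denseSeq E
  have hset : (fun ω => ‖A ω‖) ⁻¹' Set.Iic c
      = ⋂ n, ⋂ m, {ω | ‖inner ℂ (e n) (A ω (e m))‖ ≤ c * ‖e m‖ * ‖e n‖} := by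
    ext ω
    simp only [Set.mem_preimage, Set.mem_Iic, Set.mem_iInter, Set.mem_ofPred_eq]
    constructor
    · intro h n m
      refine (norm_inner_le_norm _ _).trans ?_
      rw [mul_comm]
      gcongr
      exact (A ω).le_of_opNorm_le h _
    · intro h
      have h2 : ∀ u v : E, ‖inner ℂ u (A ω v)‖ ≤ c * ‖v‖ * ‖u‖ :=
        (TopologicalSpace.denseRange_denseSeq E).induction_on₂
          (isClosed_le (by fun_prop) (by fun_prop)) h
      refine (A ω).opNorm_le_bound hc fun v => ?_
      have h3 := h2 (A ω v) v
      rw [inner_self_eq_norm_sq_to_K, norm_pow, RCLike.norm_ofReal, abs_of_nonneg (norm_nonneg _),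
        sq] at h3
      rcases (norm_nonneg (A ω v)).eq_or_lt with h4 | h4
      · rw [← h4]; positivity
      · exact le_of_mul_le_mul_right h3 h4
  rw [hset]
  exact MeasurableSet.iInter fun n => MeasurableSet.iInter fun m =>
    measurableSet_le (hA _ _).norm measurable_const

end WeaklyMeasurable

/-- There is a weakly measurable family of operators that are functions of the `T ω`, with
symbol `f`. -/
def IsMeasurableSymbol (T : Ω → E →ₗ.[ℂ] E) (f : ℝ → ℂ) : Prop :=
  ∃ A : Ω → E →L[ℂ] E, WeaklyMeasurable A ∧ ∀ ω, IsDiagonal (T ω) (A ω) f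

namespace IsMeasurableSymbol

variable {T : Ω → E →ₗ.[ℂ] E} {f g : ℝ → ℂ}

theorem zero : IsMeasurableSymbol T 0 :=
  ⟨fun _ => 0, fun _ _ => by simp, fun _ => IsDiagonal.zero⟩

theorem one : IsMeasurableSymbol T 1 :=
  ⟨fun _ => 1, fun _ _ => measurable_const, fun _ => IsDiagonal.one⟩

theorem add (hf : IsMeasurableSymbol T f) (hg : IsMeasurableSymbol T g) :
    IsMeasurableSymbol T (f + g) := by
  obtain ⟨A, hA, hA'⟩ := hf
  obtain ⟨B, hB, hB'⟩ := hg
  refine ⟨fun ω => A ω + B ω, fun φ ψ => ?_, fun ω => (hA' ω).add (hB' ω)⟩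
  simp only [add_apply, inner_add_right]
  exact (hA φ ψ).add (hB φ ψ)

theorem smul (c : ℂ) (hf : IsMeasurableSymbol T f) : IsMeasurableSymbol T (c • f) := by
  obtain ⟨A, hA, hA'⟩ := hf
  refine ⟨fun ω => c • A ω, fun φ ψ => ?_, fun ω => (hA' ω).smul c⟩
  simpa only [smul_apply, inner_smul_right] using (hA φ ψ).const_mul c

theorem sub (hf : IsMeasurableSymbol T f) (hg : IsMeasurableSymbol T g) :
    IsMeasurableSymbol T (f - g) := by
  simpa [sub_eq_add_neg] using hf.add (hg.smul (-1))

variable [CompleteSpace E]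

theorem indicator_of_tendsto (hT : ∀ ω, IsSelfAdjoint (T ω))
    (hp : ∀ ω, HasPurePointSpectrum (T ω)) {f : ℕ → ℝ → ℂ} {S : Set ℝ}
    (hf : ∀ n, IsMeasurableSymbol T (f n)) (hb : ∀ n a, ‖f n a‖ ≤ 1)
    (hlim : ∀ a, Tendsto (fun n => f n a) atTop (𝓝 (S.indicator 1 a))) :
    IsMeasurableSymbol T (S.indicator 1) := by
  choose A hA hA' using hf
  refine ⟨fun ω => spectralProj (T ω) S, fun φ ψ => ?_,
    fun ω => isDiagonal_spectralProj (hT ω) S⟩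
  refine measurable_of_tendsto_metrizable (fun n => hA n φ ψ) (tendsto_pi_nhds.mpr fun ω => ?_)
  exact tendsto_const_nhds.inner (IsDiagonal.tendsto (hT ω) (hp ω) (fun n => hA' n ω)
    (isDiagonal_spectralProj (hT ω) S) zero_le_one hb hlim ψ)

theorem resolvent (hp : ∀ ω, HasPurePointSpectrum (T ω))
    (hm : IsMeasurableSelfAdjointFamily T) {z : ℂ} (hz : z.im ≠ 0) :
    IsMeasurableSymbol T fun a => ((a : ℂ) - z)⁻¹ :=
  ⟨fun ω => opResolvent (T ω) z, hm.2 z hz, fun ω => isDiagonal_opResolvent (hm.1 ω) (hp ω) hz⟩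

variable [SecondCountableTopology E]

theorem mul (hf : IsMeasurableSymbol T f) (hg : IsMeasurableSymbol T g) :
    IsMeasurableSymbol T (f * g) := by
  obtain ⟨A, hA, hA'⟩ := hf
  obtain ⟨B, hB, hB'⟩ := hg
  exact ⟨fun ω => A ω * B ω, hA.mul hB, fun ω => (hA' ω).mul (hB' ω)⟩

theorem pow (hf : IsMeasurableSymbol T f) (n : ℕ) : IsMeasurableSymbol T (f ^ n) := by
  induction n with
  | zero => simpa using one
  | succ n ih => simpa only [pow_succ] using ih.mul hf

/-- The Lorentzian r²/((a-c)² + r²) is a multiple of a product of two resolvent symbols and exceeds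
1/2 exactly on the open interval; polynomials in it converge to the indicator. -/
theorem indicator_Ioo (hp : ∀ ω, HasPurePointSpectrum (T ω))
    (hm : IsMeasurableSelfAdjointFamily T) (c : ℝ) {r : ℝ} (hr : 0 < r) :
    IsMeasurableSymbol T ((Set.Ioo (c - r) (c + r)).indicator 1) := by
  set t : ℝ → ℝ := fun a => r ^ 2 / ((a - c) ^ 2 + r ^ 2) with ht
  have ht0 : ∀ a, 0 ≤ t a := fun a => by positivity
  have ht1 : ∀ a, t a ≤ 1 := fun a => by
    rw [ht, div_le_one (by positivity)]
    nlinarith [sq_nonneg (a - c)]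
  have hh : IsMeasurableSymbol T fun a => (t a : ℂ) := by
    have h1 : IsMeasurableSymbol T _ := resolvent hp hm (z := ⟨c, r⟩) hr.ne'
    have h2 : IsMeasurableSymbol T _ := resolvent hp hm (z := ⟨c, -r⟩) (by simpa using hr.ne')
    convert (h1.mul h2).smul ((r : ℂ) ^ 2) using 1
    ext a
    have e : ((a : ℂ) - ⟨c, r⟩) * ((a : ℂ) - ⟨c, -r⟩) = (((a - c) ^ 2 + r ^ 2 : ℝ) : ℂ) := by
      apply Complex.ext
      · simp [sq]
      · simp [sq]; ring
    simp only [Pi.smul_apply, Pi.mul_apply, smul_eq_mul]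
    rw [← mul_inv, e, ht]
    push_cast
    rw [div_eq_mul_inv]
  refine indicator_of_tendsto hm.1 hp
    (f := fun n => 1 - (1 - ((n : ℂ) + 1)⁻¹ • (fun a => (t a : ℂ)) ^ (n + 1)) ^ 2 ^ (n + 1))
    (fun n => one.sub ((one.sub ((hh.pow (n + 1)).smul _)).pow _)) (fun n a => ?_) fun a => ?_
  all_goals
    have e : ∀ n : ℕ, (1 - (1 - ((n : ℂ) + 1)⁻¹ • (fun a => (t a : ℂ)) ^ (n + 1)) ^ 2 ^ (n + 1) :
        ℝ → ℂ) a = ((1 - (1 - t a ^ (n + 1) / ((n : ℝ) + 1)) ^ 2 ^ (n + 1) : ℝ) : ℂ) := fun n => by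
      simp only [Pi.sub_apply, Pi.pow_apply, Pi.smul_apply, Pi.one_apply, smul_eq_mul]
      push_cast
      rw [div_eq_inv_mul]
  · rw [e, Complex.norm_real, Real.norm_eq_abs, abs_le]
    have h1 : t a ^ (n + 1) / ((n : ℝ) + 1) ≤ 1 := by
      rw [div_le_one (by positivity)]
      exact (pow_le_one₀ (ht0 a) (ht1 a)).trans (by linarith [n.cast_nonneg (α := ℝ)])
    have h2 : 0 ≤ t a ^ (n + 1) / ((n : ℝ) + 1) := div_nonneg (pow_nonneg (ht0 a) _) (by positivity)
    have h3 := pow_nonneg (sub_nonneg.mpr h1) (2 ^ (n + 1))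
    have h4 := pow_le_one₀ (n := 2 ^ (n + 1)) (sub_nonneg.mpr h1) (by linarith)
    constructor <;> linarith
  · simp only [e]
    have hpos : 0 < (a - c) ^ 2 + r ^ 2 := by positivity
    by_cases ha : a ∈ Set.Ioo (c - r) (c + r)
    · rw [Set.indicator_of_mem ha, Pi.one_apply, ← Complex.ofReal_one]
      refine (Complex.continuous_ofReal.tendsto 1).comp
        (tendsto_one_sub_pow_of_half_lt ?_ (ht1 a))
      rw [ht, lt_div_iff₀ hpos]
      have : (a - c) ^ 2 < r ^ 2 := sq_lt_sq' (by linarith [ha.1]) (by linarith [ha.2])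
      linarith
    · rw [Set.indicator_of_notMem ha, ← Complex.ofReal_zero]
      refine (Complex.continuous_ofReal.tendsto 0).comp
        (tendsto_one_sub_pow_of_le_half (ht0 a) ?_)
      rw [ht, div_le_iff₀ hpos]
      have : r ≤ |a - c| := by
        by_contra h
        have := abs_lt.mp (not_le.mp h)
        exact ha ⟨by linarith, by linarith⟩
      have := pow_le_pow_left₀ hr.le this 2
      rw [sq_abs] at this
      linarith

/-- A π-λ argument from rational intervals; countable disjoint unions are strong limits of partial
sums. -/
theorem indicator (hp : ∀ ω, HasPurePointSpectrum (T ω))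
    (hm : IsMeasurableSelfAdjointFamily T) {S : Set ℝ} (hS : MeasurableSet S) :
    IsMeasurableSymbol T (S.indicator 1) := by
  induction S, hS using MeasurableSpace.induction_on_inter
    (h_eq := BorelSpace.measurable_eq.trans Real.borel_eq_generateFrom_Ioo_rat)
    (h_inter := Real.isPiSystem_Ioo_rat) with
  | empty =>
    rw [Set.indicator_empty]
    exact zero
  | basic S hS =>
    simp only [Set.mem_iUnion, Set.mem_singleton_iff] at hS
    obtain ⟨l, u, hlu, rfl⟩ := hS
    have hlu' : (l : ℝ) < u := by exact_mod_cast hlu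
    have h := indicator_Ioo hp hm (((l : ℝ) + u) / 2) (r := ((u : ℝ) - l) / 2) (by linarith)
    convert h using 3 <;> ring
  | compl S hS ih =>
    rw [Set.indicator_compl]
    exact one.sub ih
  | iUnion S hd hS ih =>
    have hsum : ∀ n : ℕ, IsMeasurableSymbol T (∑ i ∈ Finset.range n, (S i).indicator 1) := by
      intro n
      induction n with
      | zero => simpa using zero
      | succ n ihn => rw [Finset.sum_range_succ]; exact ihn.add (ih n)
    have hval : ∀ (n j : ℕ) (a : ℝ), a ∈ S j →
        (∑ i ∈ Finset.range n, (S i).indicator (1 : ℝ → ℂ)) a = if j < n then 1 else 0 := by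
      intro n j a ha
      rw [Finset.sum_apply]
      have : ∀ i, (S i).indicator (1 : ℝ → ℂ) a = if j = i then 1 else 0 := fun i => by
        split_ifs with h
        · subst h; simp [ha]
        · exact Set.indicator_of_notMem
            (fun hi => Set.disjoint_left.mp (hd h) ha hi) _
      simp [this]
    have hval0 : ∀ (n : ℕ) (a : ℝ), (a ∉ ⋃ i, S i) →
        (∑ i ∈ Finset.range n, (S i).indicator (1 : ℝ → ℂ)) a = 0 := by
      intro n a ha
      rw [Finset.sum_apply]
      exact Finset.sum_eq_zero fun i _ => Set.indicator_of_notMem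
        (fun hi => ha (Set.mem_iUnion.mpr ⟨i, hi⟩)) _
    refine indicator_of_tendsto hm.1 hp hsum (fun n a => ?_) fun a => ?_
    · by_cases ha : a ∈ ⋃ i, S i
      · obtain ⟨j, hj⟩ := Set.mem_iUnion.mp ha
        rw [hval n j a hj]; split_ifs <;> simp
      · rw [hval0 n a ha]; simp
    · by_cases ha : a ∈ ⋃ i, S i
      · obtain ⟨j, hj⟩ := Set.mem_iUnion.mp ha
        rw [Set.indicator_of_mem ha]
        refine tendsto_const_nhds.congr' ?_
        filter_upwards [eventually_gt_atTop j] with n hn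
        rw [hval n j a hj, if_pos hn, Pi.one_apply]
      · rw [Set.indicator_of_notMem ha]
        exact tendsto_const_nhds.congr fun n => (hval0 n a ha).symm

end IsMeasurableSymbol

theorem weaklyMeasurable_spectralProj [CompleteSpace E] [SecondCountableTopology E]
    {T : Ω → E →ₗ.[ℂ] E} (hp : ∀ ω, HasPurePointSpectrum (T ω))
    (hm : IsMeasurableSelfAdjointFamily T) {S : Set ℝ} (hS : MeasurableSet S) :
    WeaklyMeasurable fun ω => spectralProj (T ω) S := by
  obtain ⟨A, hA, hA'⟩ := IsMeasurableSymbol.indicator hp hm hS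
  have h : (fun ω => spectralProj (T ω) S) = A := funext fun ω =>
    (isDiagonal_spectralProj (hm.1 ω) S).ext (hp ω) (hA' ω)
  rwa [h]

end WeakMeasurability

end RandomOperator

end

noncomputable section

namespace RandomOperator

open Filter Topology

/-! ### Measurability of sums over eigenvalues. -/

section EigenSum

theorem enorm_le_liminf {E : Type*} [NormedAddCommGroup E] [InnerProductSpace ℂ E]
    {A : ℕ → E →L[ℂ] E} {B : E →L[ℂ] E} (h : ∀ u, Tendsto (fun n => A n u) atTop (𝓝 (B u))) :
    ‖B‖ₑ ≤ liminf (fun n => ‖A n‖ₑ) atTop := by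
  refine ContinuousLinearMap.opENorm_le_bound _ fun u => ?_
  rw [mul_comm, ← ENNReal.liminf_const_mul_of_ne_top enorm_ne_top, ← (h u).enorm.liminf_eq]
  exact liminf_le_liminf (Eventually.of_forall fun n => mul_comm ‖A n‖ₑ _ ▸ (A n).le_opENorm u)

/-- Fatou's lemma for the counting measure on `s`. -/
theorem sum_liminf_le_liminf_sum {ι : Type*} (s : Finset ι) (f : ℕ → ι → ℝ≥0∞) :
    ∑ i ∈ s, liminf (fun n => f n i) atTop ≤ liminf (fun n => ∑ i ∈ s, f n i) atTop := by
  let _ : MeasurableSpace ι := ⊤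
  have h := lintegral_liminf_le (μ := ∑ i ∈ s, Measure.dirac i) (u := atTop) (f := f)
    fun n => measurable_from_top
  simpa [lintegral_finsetSum_measure] using h

variable {D : ℕ} {U : Set (Fin D → ℝ)}

theorem enorm_chi_spectralProj_chi_le_eigenSum {T : L2 U →ₗ.[ℂ] L2 U} (hT : IsSelfAdjoint T)
    (hp : HasPurePointSpectrum T) (S : Set ℝ) (x y : Fin D → ℝ) :
    ‖chi U x ∘L spectralProj T S ∘L chi U y‖ₑ ≤ eigenSum T S 1 x y := by
  have h := (isDiagonal_spectralProj hT S).enorm_comp_comp_le hT hp (norm_chi_le U x)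
    (norm_chi_le U y) (I := S) (C := 1) (c := 0)
    (fun a => by by_cases ha : a ∈ S <;> simp [ha]) le_rfl (fun a ha => by simp [ha])
  rw [ENNReal.ofReal_zero, add_zero] at h
  refine h.trans (ENNReal.tsum_le_tsum fun a => ?_)
  by_cases ha : a ∈ S <;> simp [ha, eigenKernel]

/-- The partition of `ℝ` into intervals of length `1 / (n + 1)`. -/
def cell (n : ℕ) (k : ℤ) : Set ℝ := {a | ⌊a * ((n : ℝ) + 1)⌋ = k}

theorem measurableSet_cell (n : ℕ) (k : ℤ) : MeasurableSet (cell n k) :=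
  (Int.measurable_floor.comp (measurable_id.mul_const _)) (measurableSet_singleton k)

theorem abs_sub_lt_of_mem_cell {n : ℕ} {k : ℤ} {a b : ℝ} (ha : a ∈ cell n k)
    (hb : b ∈ cell n k) : |a - b| < 1 / ((n : ℝ) + 1) := by
  have h := Int.abs_sub_lt_one_of_floor_eq_floor
    ((show ⌊a * ((n : ℝ) + 1)⌋ = k from ha).trans (show ⌊b * ((n : ℝ) + 1)⌋ = k from hb).symm)
  rw [← sub_mul, abs_mul, abs_of_pos (show (0 : ℝ) < (n : ℝ) + 1 by positivity)] at h
  rwa [lt_div_iff₀ (by positivity)]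

theorem eventually_notMem_cell {a b : ℝ} (hab : a ≠ b) :
    ∀ᶠ n : ℕ in atTop, b ∉ cell n ⌊a * ((n : ℝ) + 1)⌋ := by
  have h := tendsto_one_div_add_atTop_nhds_zero_nat (𝕜 := ℝ)
  filter_upwards [h.eventually_lt_const (abs_pos.mpr (sub_ne_zero.mpr hab))] with n hn hb
  have ha : a ∈ cell n ⌊a * ((n : ℝ) + 1)⌋ := rfl
  exact absurd (abs_sub_lt_of_mem_cell ha hb) (not_lt.mpr hn.le)

/-- The cells containing a shrink to a, so their projections converge strongly to P_a, and the
operator norm is lower semicontinuous under strong convergence. -/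
theorem eigenKernel_rpow_le_liminf {T : L2 U →ₗ.[ℂ] L2 U} (hT : IsSelfAdjoint T)
    (hp : HasPurePointSpectrum T) {S : Set ℝ} {r : ℝ} (hr : 0 < r) (x y : Fin D → ℝ) {a : ℝ}
    (ha : a ∈ S) :
    eigenKernel T x y a ^ r ≤ liminf (fun n : ℕ =>
      ‖chi U x ∘L spectralProj T (S ∩ cell n ⌊a * ((n : ℝ) + 1)⌋) ∘L chi U y‖ₑ ^ r) atTop := by
  have h : eigenKernel T x y a ≤ liminf (fun n : ℕ =>
      ‖chi U x ∘L spectralProj T (S ∩ cell n ⌊a * ((n : ℝ) + 1)⌋) ∘L chi U y‖ₑ) atTop := by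
    refine enorm_le_liminf fun u => ((chi U x).continuous.tendsto _).comp ?_
    refine IsDiagonal.tendsto hT hp (fun n => isDiagonal_spectralProj hT _)
      (isDiagonal_eigenProj hT a) zero_le_one (fun n b => ?_) (fun b => ?_) (chi U y u)
    · by_cases hb : b ∈ S ∩ cell n ⌊a * ((n : ℝ) + 1)⌋
      · rw [Set.indicator_of_mem hb]; simp
      · rw [Set.indicator_of_notMem hb]; simp
    · by_cases hb : a = b
      · subst hb
        refine tendsto_const_nhds.congr fun n => ?_
        rw [Set.indicator_of_mem (Set.mem_singleton a),
          Set.indicator_of_mem (show a ∈ S ∩ cell n ⌊a * ((n : ℝ) + 1)⌋ from ⟨ha, rfl⟩)]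
      · rw [Set.indicator_of_notMem (fun h => hb (Set.mem_singleton_iff.mp h).symm)]
        refine tendsto_const_nhds.congr' ?_
        filter_upwards [eventually_notMem_cell hb] with n hn
        rw [Set.indicator_of_notMem fun h => hn h.2]
  have h2 := (ENNReal.orderIsoRpow r hr).liminf_apply (f := atTop) (u := fun n : ℕ =>
    ‖chi U x ∘L spectralProj T (S ∩ cell n ⌊a * ((n : ℝ) + 1)⌋) ∘L chi U y‖ₑ)
  simp only [ENNReal.orderIsoRpow_apply] at h2
  rw [← h2]
  exact ENNReal.rpow_le_rpow h hr.le

/-- A sum over random eigenvalues is expressed through spectral projections of fixed sets, which are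
measurable in ω. Merging eigenvalues into cells cannot increase the sum when r ≤ 1. Conversely, fine
cells separate any finite set of eigenvalues, and Fatou recovers their contribution. -/
theorem eigenSum_eq_iSup {T : L2 U →ₗ.[ℂ] L2 U} (hT : IsSelfAdjoint T)
    (hp : HasPurePointSpectrum T) (S : Set ℝ) {r : ℝ} (hr0 : 0 < r) (hr1 : r ≤ 1)
    (x y : Fin D → ℝ) :
    eigenSum T S r x y
      = ⨆ n : ℕ, ∑' k : ℤ, ‖chi U x ∘L spectralProj T (S ∩ cell n k) ∘L chi U y‖ₑ ^ r := by
  classical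
  refine le_antisymm ?_ (iSup_le fun n => ?_)
  · rw [eigenSum, ENNReal.tsum_eq_iSup_sum]
    refine iSup_le fun s => ?_
    simp only [Set.indicator_apply, ← Finset.sum_filter]
    set G := s.filter fun a => a ∈ S
    have h1 : ∑ a ∈ G, eigenKernel T x y a ^ r ≤ ∑ a ∈ G, liminf (fun n : ℕ =>
        ‖chi U x ∘L spectralProj T (S ∩ cell n ⌊a * ((n : ℝ) + 1)⌋) ∘L chi U y‖ₑ ^ r) atTop :=
      Finset.sum_le_sum fun a ha =>
        eigenKernel_rpow_le_liminf hT hp hr0 x y (Finset.mem_filter.mp ha).2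
    refine h1.trans ((sum_liminf_le_liminf_sum G _).trans ?_)
    have hinj : ∀ᶠ n : ℕ in atTop, ∀ a ∈ G, ∀ b ∈ G,
        ⌊a * ((n : ℝ) + 1)⌋ = ⌊b * ((n : ℝ) + 1)⌋ → a = b := by
      simp only [Finset.eventually_all]
      intro a _ b _
      by_cases hab : a = b
      · exact Eventually.of_forall fun _ _ => hab
      · filter_upwards [eventually_notMem_cell hab] with n hn h
        exact absurd h.symm hn
    refine liminf_le_of_frequently_le' (Eventually.frequently ?_)
    filter_upwards [hinj] with n hn
    refine le_trans ?_ (le_iSup _ n)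
    refine le_trans (le_of_eq ?_) (ENNReal.sum_le_tsum (G.image fun a => ⌊a * ((n : ℝ) + 1)⌋))
    rw [Finset.sum_image fun a ha b hb h => hn a ha b hb h]
  · calc ∑' k : ℤ, ‖chi U x ∘L spectralProj T (S ∩ cell n k) ∘L chi U y‖ₑ ^ r
        ≤ ∑' k : ℤ, ∑' a : ℝ, (S ∩ cell n k).indicator (fun a => eigenKernel T x y a ^ r) a := by
          refine ENNReal.tsum_le_tsum fun k => ?_
          refine (ENNReal.rpow_le_rpow
            (enorm_chi_spectralProj_chi_le_eigenSum hT hp _ x y) hr0.le).trans ?_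
          refine (tsum_rpow_le _ hr0 hr1).trans (ENNReal.tsum_le_tsum fun a => ?_)
          by_cases ha : a ∈ S ∩ cell n k
          · rw [Set.indicator_of_mem ha, Set.indicator_of_mem ha, ENNReal.rpow_one]
          · rw [Set.indicator_of_notMem ha, ENNReal.zero_rpow_of_pos hr0]; exact zero_le
      _ = ∑' a : ℝ, ∑' k : ℤ, (S ∩ cell n k).indicator (fun a => eigenKernel T x y a ^ r) a :=
          ENNReal.tsum_comm
      _ ≤ eigenSum T S r x y := by
          refine ENNReal.tsum_le_tsum fun a => ?_
          rw [tsum_eq_single ⌊a * ((n : ℝ) + 1)⌋ fun k hk =>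
            Set.indicator_of_notMem (fun h => hk h.2.symm) _]
          exact Set.indicator_le_indicator_of_subset Set.inter_subset_left (fun _ => zero_le) a

theorem measurable_eigenSum {Ω : Type*} [MeasurableSpace Ω] {T : Ω → L2 U →ₗ.[ℂ] L2 U}
    (hp : ∀ ω, HasPurePointSpectrum (T ω)) (hm : IsMeasurableSelfAdjointFamily T) {S : Set ℝ}
    (hS : MeasurableSet S) {r : ℝ} (hr0 : 0 < r) (hr1 : r ≤ 1) (x y : Fin D → ℝ) :
    Measurable fun ω => eigenSum (T ω) S r x y := by
  -- Needed for the separability of L².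
  have : Fact ((2 : ℝ≥0∞) ≠ ∞) := ⟨by simp⟩
  simp only [fun ω => eigenSum_eq_iSup (hm.1 ω) (hp ω) S hr0 hr1 x y]
  exact Measurable.iSup fun n => Measurable.tsum fun k =>
    (((weaklyMeasurable_spectralProj hp hm (hS.inter (measurableSet_cell n k))).comp_comp
      (chi U x) (chi U y)).measurable_enorm).pow_const r

end EigenSum

end RandomOperator

end

noncomputable section

namespace RandomOperator

open Filter Topology

/-! ### Moments of eigenvalue sums, and the dyadic decomposition. -/

section Moments

variable {D : ℕ} {Ω : Type*} [MeasurableSpace Ω] {P : Measure Ω}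

theorem eigenSum_one_le_add {U : Set (Fin D → ℝ)} (T : L2 U →ₗ.[ℂ] L2 U) (S : Set ℝ)
    {r : ℝ} (hr : 0 ≤ r) (x y : Fin D → ℝ) :
    eigenSum T S r x y ≤ eigenSum T S r x x + eigenSum T S r y y := by
  rw [eigenSum, eigenSum, eigenSum, ← ENNReal.tsum_add]
  refine ENNReal.tsum_le_tsum fun a => ?_
  by_cases ha : a ∈ S
  · simp only [Set.indicator_of_mem ha]
    rcases le_max_iff.mp (eigenKernel_le_max T x y a) with h | h
    · exact le_add_right (ENNReal.rpow_le_rpow h hr)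
    · exact le_add_left (ENNReal.rpow_le_rpow h hr)
  · simp [ha]

/-- Below the threshold k the first term suffices, above it the second. The free choice of k later
optimises the decay. -/
theorem rpow_le_mul_rpow_half_add (a : ℝ≥0∞) {k s : ℝ} (hk : 0 < k) (hs0 : 1 / 2 < s)
    (hs1 : s < 1) :
    a ^ s ≤ ENNReal.ofReal (k ^ (s - 1 / 2)) * a ^ (1 / 2 : ℝ)
      + ENNReal.ofReal (k ^ (s - 1)) * a ^ (1 : ℝ) := by
  have hk0 : ENNReal.ofReal k ≠ 0 := by simpa using hk
  rw [← ENNReal.ofReal_rpow_of_pos hk, ← ENNReal.ofReal_rpow_of_pos hk]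
  rcases le_total a (ENNReal.ofReal k) with h | h
  · refine le_add_right ?_
    calc a ^ s = a ^ (s - 1 / 2) * a ^ (1 / 2 : ℝ) := by
          rw [← ENNReal.rpow_add_of_nonneg _ _ (by linarith) (by norm_num)]; congr 1; ring
      _ ≤ _ := by gcongr
  · refine le_add_left ?_
    rcases eq_or_ne a ∞ with rfl | ha
    · rw [ENNReal.top_rpow_of_pos one_pos, ENNReal.mul_top]
      · exact le_top
      · exact (ENNReal.rpow_pos (pos_iff_ne_zero.mpr hk0) ENNReal.ofReal_ne_top).ne'
    have ha0 : a ≠ 0 := fun h0 => hk0 (le_antisymm (h0 ▸ h) zero_le)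
    calc a ^ s = a ^ (s - 1) * a ^ (1 : ℝ) := by
          rw [← ENNReal.rpow_add _ _ ha0 ha]; congr 1; ring
      _ ≤ _ := by
          refine mul_le_mul_left ?_ _
          rw [← neg_sub 1 s, ENNReal.rpow_neg, ENNReal.rpow_neg, ENNReal.inv_le_inv]
          exact ENNReal.rpow_le_rpow h (by linarith)

theorem eigenSum_le_mul_half_add {U : Set (Fin D → ℝ)} (T : L2 U →ₗ.[ℂ] L2 U) (S : Set ℝ)
    {k s : ℝ} (hk : 0 < k) (hs0 : 1 / 2 < s) (hs1 : s < 1) (x y : Fin D → ℝ) :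
    eigenSum T S s x y ≤ ENNReal.ofReal (k ^ (s - 1 / 2)) * eigenSum T S (1 / 2) x y
      + ENNReal.ofReal (k ^ (s - 1)) * eigenSum T S 1 x y := by
  simp only [eigenSum]
  rw [← ENNReal.tsum_mul_left, ← ENNReal.tsum_mul_left, ← ENNReal.tsum_add]
  refine ENNReal.tsum_le_tsum fun a => ?_
  by_cases ha : a ∈ S
  · simp only [Set.indicator_of_mem ha]
    exact rpow_le_mul_rpow_half_add _ hk hs0 hs1
  · simp [ha]

theorem eigenSum_half_self_le {U : Set (Fin D → ℝ)} (T : L2 U →ₗ.[ℂ] L2 U) (S : Set ℝ)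
    (x : Fin D → ℝ) :
    eigenSum T S (1 / 2) x x ≤ ∑' e : Fin D → Bool, ∑' y : Fin D → ℤ,
      eigenSum T S 1 (fun i => (y i : ℝ)) (fun i => (nearLattice x e i : ℝ)) := by
  have h : ∀ a, S.indicator (fun a => eigenKernel T x x a ^ (1 / 2 : ℝ)) a
      ≤ ∑' e : Fin D → Bool, ∑' y : Fin D → ℤ, S.indicator (fun a =>
        eigenKernel T (fun i => (y i : ℝ)) (fun i => (nearLattice x e i : ℝ)) a ^ (1 : ℝ)) a := by
    intro a
    by_cases ha : a ∈ S
    · simpa only [Set.indicator_of_mem ha, ENNReal.rpow_one] using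
        eigenKernel_self_rpow_half_le T x a
    · simp [ha]
  refine (ENNReal.tsum_le_tsum h).trans (le_of_eq ?_)
  rw [ENNReal.tsum_comm]
  exact tsum_congr fun e => ENNReal.tsum_comm

variable {𝔒 : Set (Set (Fin D → ℝ))} {HO : (U : Set (Fin D → ℝ)) → Ω → L2 U →ₗ.[ℂ] L2 U}

/-- The Wegner estimate concerns the diagonal; an off-diagonal kernel is at most the sum of two
diagonal ones, which doubles the constant. -/
theorem lintegral_eigenSum_one_le_of_wegner
    (hm : ∀ U ∈ 𝔒, IsMeasurableSelfAdjointFamily (HO U))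
    (hp : ∀ U ∈ 𝔒, ∀ ω, HasPurePointSpectrum (HO U ω))
    (hW : WegnerEstimate P 𝔒 HO) {I : Set ℝ} (hI : I.OrdConnected)
    (hIb : Bornology.IsBounded I) :
    ∃ K : ℝ, 0 < K ∧ ∀ x y : Fin D → ℝ, ∀ U ∈ 𝔒, ∀ S : Set ℝ, S.OrdConnected → S ⊆ I →
      ∀ v : ℝ, 0 ≤ v → volume S ≤ ENNReal.ofReal v →
      ∫⁻ ω, eigenSum (HO U ω) S 1 x y ∂P ≤ ENNReal.ofReal (K * v) := by
  obtain ⟨K, hK, h⟩ := hW I hI hIb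
  have hself : ∀ x : Fin D → ℝ, ∀ U ∈ 𝔒, ∀ S : Set ℝ, S.OrdConnected → S ⊆ I →
      ∀ v : ℝ, 0 ≤ v → volume S ≤ ENNReal.ofReal v →
      ∫⁻ ω, eigenSum (HO U ω) S 1 x x ∂P ≤ ENNReal.ofReal (K * v) := by
    intro x U hU S hS hSI v hv hvol
    refine (lintegral_mono fun ω =>
      eigenSum_self_le_posTrace ((hm U hU).1 ω) (hp U hU ω) S x).trans ?_
    refine (h x U hU S hS hSI).trans ?_
    rw [ENNReal.ofReal_mul hK.le]
    gcongr
  refine ⟨2 * K, by positivity, fun x y U hU S hS hSI v hv hvol => ?_⟩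
  calc ∫⁻ ω, eigenSum (HO U ω) S 1 x y ∂P
      ≤ ∫⁻ ω, (eigenSum (HO U ω) S 1 x x + eigenSum (HO U ω) S 1 y y) ∂P :=
        lintegral_mono fun ω => eigenSum_one_le_add _ S zero_le_one x y
    _ = ∫⁻ ω, eigenSum (HO U ω) S 1 x x ∂P + ∫⁻ ω, eigenSum (HO U ω) S 1 y y ∂P :=
        lintegral_add_left (measurable_eigenSum (hp U hU) (hm U hU) hS.measurableSet one_pos
          le_rfl x x) _
    _ ≤ ENNReal.ofReal (K * v) + ENNReal.ofReal (K * v) :=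
        add_le_add (hself x U hU S hS hSI v hv hvol) (hself y U hU S hS hSI v hv hvol)
    _ = ENNReal.ofReal (2 * K * v) := by
        rw [← ENNReal.ofReal_add (by positivity) (by positivity)]; congr 1; ring

/-- Interpolation between the Wegner estimate and the decay of the eigenfunction correlator. -/
theorem lintegral_eigenSum_one_le
    (hm : ∀ U ∈ 𝔒, IsMeasurableSelfAdjointFamily (HO U))
    (hp : ∀ U ∈ 𝔒, ∀ ω, HasPurePointSpectrum (HO U ω))
    (hW : WegnerEstimate P 𝔒 HO) {I : Set ℝ} (hI : I.OrdConnected)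
    (hIb : Bornology.IsBounded I) (d : PseudoMetric (Fin D → ℝ) ℝ) {C μ γ : ℝ} (hC : 0 < C)
    (hEC : ∀ x y : Fin D → ℝ, ∀ U ∈ 𝔒,
      ∫⁻ ω, eigenfunctionCorrelator (HO U ω) I x y ∂P
        ≤ ENNReal.ofReal (C * Real.exp (-μ * d x y ^ γ)))
    {θ : ℝ} (hθ0 : 0 ≤ θ) (hθ1 : θ ≤ 1) :
    ∃ K : ℝ, 0 < K ∧ ∀ x y : Fin D → ℝ, ∀ U ∈ 𝔒, ∀ S : Set ℝ, S.OrdConnected → S ⊆ I →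
      ∀ v : ℝ, 0 ≤ v → volume S ≤ ENNReal.ofReal v →
      ∫⁻ ω, eigenSum (HO U ω) S 1 x y ∂P
        ≤ ENNReal.ofReal (K * v ^ (1 - θ) * Real.exp (-(θ * μ) * d x y ^ γ)) := by
  obtain ⟨K, hK, h⟩ := lintegral_eigenSum_one_le_of_wegner hm hp hW hI hIb
  refine ⟨K ^ (1 - θ) * C ^ θ, by positivity, fun x y U hU S hS hSI v hv hvol => ?_⟩
  have h1 := h x y U hU S hS hSI v hv hvol
  have h2 : ∫⁻ ω, eigenSum (HO U ω) S 1 x y ∂P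
      ≤ ENNReal.ofReal (C * Real.exp (-μ * d x y ^ γ)) := by
    refine (lintegral_mono fun ω => ?_).trans (hEC x y U hU)
    rw [eigenfunctionCorrelator_eq_eigenSum]
    exact eigenSum_mono hSI 1 x y
  have e1 : Real.exp (-(θ * μ) * d x y ^ γ) = Real.exp (-μ * d x y ^ γ) ^ θ := by
    rw [← Real.exp_mul]; congr 1; ring
  -- Of the two factors, the power 1 - θ is estimated by Wegner and the power θ by the correlator.
  calc ∫⁻ ω, eigenSum (HO U ω) S 1 x y ∂P
      = (∫⁻ ω, eigenSum (HO U ω) S 1 x y ∂P) ^ (1 - θ)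
          * (∫⁻ ω, eigenSum (HO U ω) S 1 x y ∂P) ^ θ := by
        rw [← ENNReal.rpow_add_of_nonneg _ _ (by linarith) hθ0, sub_add_cancel, ENNReal.rpow_one]
    _ ≤ ENNReal.ofReal (K * v) ^ (1 - θ)
          * ENNReal.ofReal (C * Real.exp (-μ * d x y ^ γ)) ^ θ := by
        gcongr
    _ = _ := by
        rw [ENNReal.ofReal_rpow_of_nonneg (by positivity) (by linarith),
          ENNReal.ofReal_rpow_of_nonneg (by positivity) hθ0, ← ENNReal.ofReal_mul (by positivity),
          Real.mul_rpow hK.le hv, Real.mul_rpow hC.le (Real.exp_pos _).le, e1]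
        congr 1; ring

/-- The decay of the exponent-one bound is spent on the sum over lattice points; what remains is
uniform in x and keeps the power of the length. -/
theorem lintegral_eigenSum_half_self_le
    (hm : ∀ U ∈ 𝔒, IsMeasurableSelfAdjointFamily (HO U))
    (hp : ∀ U ∈ 𝔒, ∀ ω, HasPurePointSpectrum (HO U ω)) {I : Set ℝ}
    {d : PseudoMetric (Fin D → ℝ) ℝ} (hM : IsSummablePseudoMetric d) {K ν γ θ : ℝ} (hK : 0 < K)
    (hν : 0 < ν) (hγ : γ ∈ Set.Ioc (0 : ℝ) 1)
    (h : ∀ x y : Fin D → ℝ, ∀ U ∈ 𝔒, ∀ S : Set ℝ, S.OrdConnected → S ⊆ I →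
      ∀ v : ℝ, 0 ≤ v → volume S ≤ ENNReal.ofReal v →
      ∫⁻ ω, eigenSum (HO U ω) S 1 x y ∂P
        ≤ ENNReal.ofReal (K * v ^ (1 - θ) * Real.exp (-ν * d x y ^ γ))) :
    ∃ K' : ℝ, 0 ≤ K' ∧ ∀ x : Fin D → ℝ, ∀ U ∈ 𝔒, ∀ S : Set ℝ, S.OrdConnected → S ⊆ I →
      ∀ v : ℝ, 0 ≤ v → volume S ≤ ENNReal.ofReal v →
      ∫⁻ ω, eigenSum (HO U ω) S (1 / 2) x x ∂P ≤ ENNReal.ofReal (K' * v ^ (1 - θ)) := by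
  set L := ⨆ x : Fin D → ℤ, ∑' y : Fin D → ℤ,
    ENNReal.ofReal (Real.exp (-ν * d (fun i => (x i : ℝ)) (fun i => (y i : ℝ)) ^ γ)) with hL
  have hLtop : L ≠ ∞ := (hM ν hν γ hγ).ne
  refine ⟨2 ^ D * (K * L.toReal), by positivity, fun x U hU S hS hSI v hv hvol => ?_⟩
  have hmeas : ∀ x y, Measurable fun ω => eigenSum (HO U ω) S 1 x y := fun x y =>
    measurable_eigenSum (hp U hU) (hm U hU) hS.measurableSet one_pos le_rfl x y
  calc ∫⁻ ω, eigenSum (HO U ω) S (1 / 2) x x ∂P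
      ≤ ∫⁻ ω, ∑' e : Fin D → Bool, ∑' y : Fin D → ℤ, eigenSum (HO U ω) S 1
          (fun i => (y i : ℝ)) (fun i => (nearLattice x e i : ℝ)) ∂P :=
        lintegral_mono fun ω => eigenSum_half_self_le _ S x
    _ = ∑' e : Fin D → Bool, ∑' y : Fin D → ℤ, ∫⁻ ω, eigenSum (HO U ω) S 1
          (fun i => (y i : ℝ)) (fun i => (nearLattice x e i : ℝ)) ∂P := by
        rw [lintegral_tsum fun e => (Measurable.tsum fun y => hmeas _ _).aemeasurable]
        exact tsum_congr fun e => lintegral_tsum fun y => (hmeas _ _).aemeasurable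
    _ ≤ ∑' e : Fin D → Bool, ENNReal.ofReal (K * v ^ (1 - θ)) * L := by
        refine ENNReal.tsum_le_tsum fun e => ?_
        refine le_trans ?_ (mul_le_mul_right (le_iSup (fun x : Fin D → ℤ => ∑' y : Fin D → ℤ,
          ENNReal.ofReal (Real.exp (-ν * d (fun i => (x i : ℝ)) (fun i => (y i : ℝ)) ^ γ)))
          (nearLattice x e)) _)
        rw [← ENNReal.tsum_mul_left]
        refine ENNReal.tsum_le_tsum fun y => ?_
        rw [← ENNReal.ofReal_mul (by positivity), d.symm]
        exact h _ _ U hU S hS hSI v hv hvol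
    _ = ENNReal.ofReal (2 ^ D * (K * L.toReal) * v ^ (1 - θ)) := by
        rw [tsum_fintype, Finset.sum_const, Finset.card_univ, Fintype.card_fun, Fintype.card_bool,
          Fintype.card_fin, nsmul_eq_mul, ← ENNReal.ofReal_toReal hLtop,
          ← ENNReal.ofReal_mul (by positivity), ENNReal.toReal_ofReal ENNReal.toReal_nonneg,
          ← ENNReal.ofReal_natCast, ← ENNReal.ofReal_mul (by positivity)]
        congr 1; push_cast; ring

/-- Fractional powers of the eigenfunction correlator decay, with a bound that is Hölder continuous
in the length of the energy interval. -/
theorem lintegral_eigenSum_rpow_le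
    (hm : ∀ U ∈ 𝔒, IsMeasurableSelfAdjointFamily (HO U))
    (hp : ∀ U ∈ 𝔒, ∀ ω, HasPurePointSpectrum (HO U ω))
    (hW : WegnerEstimate P 𝔒 HO) {I : Set ℝ} (hI : I.OrdConnected)
    (hIb : Bornology.IsBounded I) {d : PseudoMetric (Fin D → ℝ) ℝ}
    (hM : IsSummablePseudoMetric d) {C μ γ : ℝ} (hC : 0 < C) (hμ : 0 < μ)
    (hγ : γ ∈ Set.Ioc (0 : ℝ) 1)
    (hEC : ∀ x y : Fin D → ℝ, ∀ U ∈ 𝔒,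
      ∫⁻ ω, eigenfunctionCorrelator (HO U ω) I x y ∂P
        ≤ ENNReal.ofReal (C * Real.exp (-μ * d x y ^ γ)))
    {θ s : ℝ} (hθ0 : 0 < θ) (hθ1 : θ ≤ 1) (hs0 : 1 / 2 < s) (hs1 : s < 1) :
    ∃ K ν : ℝ, 0 < K ∧ 0 < ν ∧ ∀ x y : Fin D → ℝ, ∀ U ∈ 𝔒, ∀ S : Set ℝ, S.OrdConnected → S ⊆ I →
      ∀ v : ℝ, 0 ≤ v → volume S ≤ ENNReal.ofReal v →
      ∫⁻ ω, eigenSum (HO U ω) S s x y ∂P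
        ≤ ENNReal.ofReal (K * v ^ (1 - θ) * Real.exp (-ν * d x y ^ γ)) := by
  obtain ⟨K₁, hK₁, h₁⟩ := lintegral_eigenSum_one_le hm hp hW hI hIb d hC hEC hθ0.le hθ1
  obtain ⟨K₂, hK₂, h₂⟩ :=
    lintegral_eigenSum_half_self_le hm hp hM hK₁ (mul_pos hθ0 hμ) hγ h₁
  refine ⟨2 * K₂ + K₁, θ * μ * (s - 1 / 2), by positivity,
    mul_pos (mul_pos hθ0 hμ) (by linarith), fun x y U hU S hS hSI v hv hvol => ?_⟩
  set t := d x y ^ γ with ht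
  have ht0 : 0 ≤ t := Real.rpow_nonneg (d.nonneg x y) γ
  -- The threshold is the decay factor of the exponent-one bound: the half-power term gains k^(s -
  -- 1/2), and the other becomes k^(s - 1) k = k^s, which is no larger.
  set k := Real.exp (-(θ * μ) * t) with hk
  have hmeas : ∀ {r : ℝ}, 0 < r → r ≤ 1 → ∀ x y,
      Measurable fun ω => eigenSum (HO U ω) S r x y := fun hr0 hr1 x y =>
    measurable_eigenSum (hp U hU) (hm U hU) hS.measurableSet hr0 hr1 x y
  have hhalf : ∫⁻ ω, eigenSum (HO U ω) S (1 / 2) x y ∂P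
      ≤ ENNReal.ofReal (2 * K₂ * v ^ (1 - θ)) := by
    calc ∫⁻ ω, eigenSum (HO U ω) S (1 / 2) x y ∂P
        ≤ ∫⁻ ω, (eigenSum (HO U ω) S (1 / 2) x x + eigenSum (HO U ω) S (1 / 2) y y) ∂P :=
          lintegral_mono fun ω => eigenSum_one_le_add _ S (by norm_num) x y
      _ = ∫⁻ ω, eigenSum (HO U ω) S (1 / 2) x x ∂P
            + ∫⁻ ω, eigenSum (HO U ω) S (1 / 2) y y ∂P :=
          lintegral_add_left (hmeas (by norm_num) (by norm_num) x x) _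
      _ ≤ ENNReal.ofReal (K₂ * v ^ (1 - θ)) + ENNReal.ofReal (K₂ * v ^ (1 - θ)) :=
          add_le_add (h₂ x U hU S hS hSI v hv hvol) (h₂ y U hU S hS hSI v hv hvol)
      _ = _ := by
          rw [← ENNReal.ofReal_add (by positivity) (by positivity)]; congr 1; ring
  have e1 : k ^ (s - 1 / 2) = Real.exp (-(θ * μ * (s - 1 / 2)) * t) := by
    rw [hk, ← Real.exp_mul]; congr 1; ring
  have e2 : k ^ (s - 1) * k ≤ Real.exp (-(θ * μ * (s - 1 / 2)) * t) := by
    rw [hk, ← Real.exp_mul, ← Real.exp_add]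
    refine Real.exp_le_exp.mpr ?_
    have : 0 ≤ θ * μ * t := by positivity
    nlinarith
  calc ∫⁻ ω, eigenSum (HO U ω) S s x y ∂P
      ≤ ∫⁻ ω, (ENNReal.ofReal (k ^ (s - 1 / 2)) * eigenSum (HO U ω) S (1 / 2) x y
          + ENNReal.ofReal (k ^ (s - 1)) * eigenSum (HO U ω) S 1 x y) ∂P :=
        lintegral_mono fun ω => eigenSum_le_mul_half_add _ S (Real.exp_pos _) hs0 hs1 x y
    _ = ENNReal.ofReal (k ^ (s - 1 / 2)) * ∫⁻ ω, eigenSum (HO U ω) S (1 / 2) x y ∂P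
          + ENNReal.ofReal (k ^ (s - 1)) * ∫⁻ ω, eigenSum (HO U ω) S 1 x y ∂P := by
        rw [lintegral_add_left ((hmeas (by norm_num) (by norm_num) x y).const_mul _),
          lintegral_const_mul' _ _ ENNReal.ofReal_ne_top,
          lintegral_const_mul' _ _ ENNReal.ofReal_ne_top]
    _ ≤ ENNReal.ofReal (k ^ (s - 1 / 2)) * ENNReal.ofReal (2 * K₂ * v ^ (1 - θ))
          + ENNReal.ofReal (k ^ (s - 1)) * ENNReal.ofReal (K₁ * v ^ (1 - θ) * k) :=
        add_le_add (mul_le_mul_right hhalf _)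
          (mul_le_mul_right (h₁ x y U hU S hS hSI v hv hvol) _)
    _ ≤ _ := by
        rw [← ENNReal.ofReal_mul (by positivity), ← ENNReal.ofReal_mul (by positivity),
          ← ENNReal.ofReal_add (by positivity) (by positivity)]
        refine ENNReal.ofReal_le_ofReal ?_
        rw [e1]
        have h3 : 0 ≤ K₁ * v ^ (1 - θ) := by positivity
        nlinarith [mul_le_mul_of_nonneg_left e2 h3]

/-- A dyadic decomposition of the eigenvalues around `re z`. -/
theorem tsum_indicator_le_tsum_eigenSum {U : Set (Fin D → ℝ)} (T : L2 U →ₗ.[ℂ] L2 U) {I : Set ℝ}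
    {z : ℂ} (hz : z.im ≠ 0) {ρ : ℝ} (hρ : 0 < ρ) (hI : I ⊆ Metric.closedBall z.re ρ) {s : ℝ}
    (hs : 0 < s) (x y : Fin D → ℝ) :
    ∑' a : ℝ, I.indicator (fun a => (‖(a : ℂ) - z‖ₑ⁻¹ * eigenKernel T x y a) ^ s) a
      ≤ ∑' k : ℕ, ENNReal.ofReal ((2 ^ (k + 1) / ρ) ^ s)
          * eigenSum T (I ∩ Metric.closedBall z.re (ρ * (1 / 2) ^ k)) s x y := by
  simp only [eigenSum, ← ENNReal.tsum_mul_left]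
  rw [ENNReal.tsum_comm]
  refine ENNReal.tsum_le_tsum fun a => ?_
  by_cases ha : a ∈ I
  · rw [Set.indicator_of_mem ha]
    have hpos : 0 < ‖(a : ℂ) - z‖ := norm_pos_iff.mpr (ofReal_sub_ne_zero hz a)
    -- The scale k is read off |a - z|; if this exceeds ρ then k = 0 serves. The balls overlap, but
    -- one admissible k per eigenvalue is enough.
    obtain ⟨k, hk1, hk2⟩ : ∃ k : ℕ, a ∈ Metric.closedBall z.re (ρ * (1 / 2) ^ k) ∧
        ρ * (1 / 2) ^ (k + 1) ≤ ‖(a : ℂ) - z‖ := by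
      rcases le_or_gt (‖(a : ℂ) - z‖) ρ with h | h
      · obtain ⟨k, h1, h2⟩ := exists_nat_pow_near_of_lt_one (x := ‖(a : ℂ) - z‖ / ρ)
          (y := (1 / 2 : ℝ)) (by positivity) ((div_le_one hρ).mpr h) (by norm_num) (by norm_num)
        rw [lt_div_iff₀' hρ] at h1
        rw [div_le_iff₀' hρ] at h2
        refine ⟨k, ?_, h1.le⟩
        rw [Metric.mem_closedBall, Real.dist_eq]
        exact le_trans (by simpa using Complex.abs_re_le_norm ((a : ℂ) - z)) h2
      · exact ⟨0, by simpa using hI ha, by rw [zero_add, pow_one]; linarith⟩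
    refine le_trans ?_ (ENNReal.le_tsum k)
    rw [Set.indicator_of_mem (show a ∈ I ∩ Metric.closedBall z.re (ρ * (1 / 2) ^ k) from
      ⟨ha, hk1⟩), ENNReal.mul_rpow_of_nonneg _ _ hs.le]
    gcongr
    rw [← ENNReal.ofReal_rpow_of_pos (by positivity)]
    gcongr
    rw [← ofReal_norm, ← ENNReal.ofReal_inv_of_pos hpos]
    refine ENNReal.ofReal_le_ofReal ?_
    rw [inv_le_comm₀ hpos (by positivity), inv_div]
    refine le_trans (le_of_eq ?_) hk2
    rw [one_div, inv_pow, div_eq_mul_inv]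
  · simp [ha]

/-- A geometric series of ratio 2^(s - (1 - θ)) < 1: the Hölder exponent beats the singularity |E -
z|^(-s). -/
theorem summable_dyadic {ρ s θ : ℝ} (hρ : 0 < ρ) (hsθ : s < 1 - θ) :
    Summable fun k : ℕ => (2 ^ (k + 1) / ρ) ^ s * (2 * (ρ * (1 / 2) ^ k)) ^ (1 - θ) := by
  have hlt : (2 : ℝ) ^ (s - (1 - θ)) < 1 := Real.rpow_lt_one_of_one_lt_of_neg (by norm_num)
    (by linarith)
  have h := (summable_geometric_of_lt_one (by positivity) hlt).mul_left
    ((2 / ρ) ^ s * (2 * ρ) ^ (1 - θ))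
  refine h.congr fun k => ?_
  have e1 : (2 : ℝ) ^ (k + 1) / ρ = 2 / ρ * 2 ^ (k : ℝ) := by
    rw [Real.rpow_natCast]; ring
  have e2 : 2 * (ρ * (1 / 2 : ℝ) ^ k) = 2 * ρ * 2 ^ (-(k : ℝ)) := by
    rw [Real.rpow_neg (by norm_num), Real.rpow_natCast, one_div, inv_pow]; ring
  have e3 : (2 / ρ * 2 ^ (k : ℝ)) ^ s = (2 / ρ) ^ s * 2 ^ ((k : ℝ) * s) := by
    rw [Real.mul_rpow (by positivity) (by positivity), ← Real.rpow_mul (by norm_num)]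
  have e4 : (2 * ρ * 2 ^ (-(k : ℝ))) ^ (1 - θ)
      = (2 * ρ) ^ (1 - θ) * 2 ^ (-(k : ℝ) * (1 - θ)) := by
    rw [Real.mul_rpow (by positivity) (by positivity), ← Real.rpow_mul (by norm_num)]
  have e5 : ((2 : ℝ) ^ (s - (1 - θ))) ^ k = 2 ^ ((k : ℝ) * s) * 2 ^ (-(k : ℝ) * (1 - θ)) := by
    rw [← Real.rpow_natCast, ← Real.rpow_mul (by norm_num), ← Real.rpow_add (by norm_num)]
    congr 1; ring
  rw [e1, e2, e3, e4, e5]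
  ring

end Moments

end RandomOperator

end

noncomputable section

namespace RandomOperator

open Filter Topology

/-! ### Fractional moments of the resolvent. -/

section FractionalMoments

/-- The segment from a to b is connected, so it cannot lie in the disjoint union of interior and
exterior. Distance to the boundary of `I` thus bounds distance to its complement. -/
theorem exists_mem_frontier_abs_sub_le {I : Set ℝ} {a b : ℝ} (ha : a ∈ I) (hb : b ∉ I) :
    ∃ c ∈ frontier I, |c - a| ≤ |b - a| := by
  by_contra! h
  have hcover : Set.uIcc a b ⊆ interior I ∪ (closure I)ᶜ := fun c hc => by
    by_contra hc'
    rw [Set.mem_union, not_or, Set.mem_compl_iff, not_not] at hc'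
    exact absurd (Set.abs_sub_left_of_mem_uIcc hc) (not_le.mpr (h c ⟨hc'.2, hc'.1⟩))
  have ha' : a ∈ interior I := (hcover Set.left_mem_uIcc).resolve_right fun h' =>
    h' (subset_closure ha)
  have hb' : b ∈ (closure I)ᶜ := (hcover Set.right_mem_uIcc).resolve_left fun h' =>
    hb (interior_subset h')
  obtain ⟨c, -, hc1, hc2⟩ := isPreconnected_uIcc (interior I) (closure I)ᶜ isOpen_interior
    isClosed_closure.isOpen_compl hcover ⟨a, Set.left_mem_uIcc, ha'⟩ ⟨b, Set.right_mem_uIcc, hb'⟩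
  exact hc2 (interior_subset_closure hc1)

theorem rpow_le_one_add {x γ : ℝ} (hx : 0 ≤ x) (hγ : γ ∈ Set.Ioc (0 : ℝ) 1) : x ^ γ ≤ 1 + x := by
  rcases le_total x 1 with h | h
  · exact (Real.rpow_le_one hx h hγ.1.le).trans (by linarith)
  · calc x ^ γ ≤ x ^ (1 : ℝ) := Real.rpow_le_rpow_of_exponent_le h hγ.2
      _ ≤ 1 + x := by rw [Real.rpow_one]; linarith

/-- With `n ≈ ε t`, the two error terms of the truncated Neumann series decay exponentially. -/
theorem exists_two_pow_mul_exp_add_pow_le {C m δ : ℝ} (hC : 0 < C) (hm : 0 < m) (hδ : 0 < δ) :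
    ∃ K c : ℝ, 0 < K ∧ 0 < c ∧ ∀ t : ℝ, 0 ≤ t → ∃ n : ℕ,
      2 ^ n * (C * Real.exp (-m * t)) + (√(1 + δ ^ 2))⁻¹ ^ n / δ ≤ K * Real.exp (-c * t) := by
  have hlog2 : 0 < Real.log 2 := Real.log_pos (by norm_num)
  -- Chosen so that 2^(ε t) = exp(m t / 2): the factor 2^n uses up half of the rate m.
  obtain ⟨ε, hε⟩ : ∃ ε, ε = m / 2 / Real.log 2 := ⟨_, rfl⟩
  have hε0 : 0 < ε := by rw [hε]; positivity
  have hgt : 1 < √(1 + δ ^ 2) := by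
    rw [Real.lt_sqrt zero_le_one]; nlinarith
  set l := Real.log √(1 + δ ^ 2) with hl
  have hl0 : 0 < l := Real.log_pos hgt
  -- The factor exp l pays for rounding ε t down to an integer.
  refine ⟨C + Real.exp l / δ, min (m / 2) (ε * l), by positivity, by positivity,
    fun t ht => ⟨⌊ε * t⌋₊, ?_⟩⟩
  have hfl : (⌊ε * t⌋₊ : ℝ) ≤ ε * t := Nat.floor_le (by positivity)
  have hfl2 : ε * t < ⌊ε * t⌋₊ + 1 := Nat.lt_floor_add_one _
  have h1 : (2 : ℝ) ^ ⌊ε * t⌋₊ * (C * Real.exp (-m * t))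
      ≤ C * Real.exp (-min (m / 2) (ε * l) * t) := by
    have e2 : (2 : ℝ) ^ ⌊ε * t⌋₊ = Real.exp (⌊ε * t⌋₊ * Real.log 2) := by
      rw [Real.exp_nat_mul, Real.exp_log (by norm_num)]
    rw [e2, mul_left_comm, ← Real.exp_add]
    refine mul_le_mul_of_nonneg_left (Real.exp_le_exp.mpr ?_) hC.le
    have e : ε * t * Real.log 2 = m / 2 * t := by rw [hε]; field_simp
    have := mul_le_mul_of_nonneg_right hfl hlog2.le
    have := mul_le_mul_of_nonneg_right (min_le_left (m / 2) (ε * l)) ht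
    linarith
  have h2 : (√(1 + δ ^ 2))⁻¹ ^ ⌊ε * t⌋₊ / δ
      ≤ Real.exp l / δ * Real.exp (-min (m / 2) (ε * l) * t) := by
    have e2 : (√(1 + δ ^ 2))⁻¹ ^ ⌊ε * t⌋₊ = Real.exp (⌊ε * t⌋₊ * -l) := by
      rw [Real.exp_nat_mul, Real.exp_neg, hl, Real.exp_log (by linarith)]
    rw [e2, div_mul_eq_mul_div (Real.exp l), ← Real.exp_add]
    refine div_le_div_of_nonneg_right ?_ hδ.le
    refine Real.exp_le_exp.mpr ?_
    have := mul_le_mul_of_nonneg_right hfl2.le hl0.le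
    have := mul_le_mul_of_nonneg_right (min_le_right (m / 2) (ε * l)) ht
    linarith
  rw [add_mul]
  exact add_le_add h1 h2

variable {D : ℕ} {Ω : Type*} [MeasurableSpace Ω] {P : Measure Ω}
  {𝔒 : Set (Set (Fin D → ℝ))} {HO : (U : Set (Fin D → ℝ)) → Ω → L2 U →ₗ.[ℂ] L2 U}

/-- Away from the real axis the Combes–Thomas bound gives exponential decay. -/
theorem CombesThomasBound.exists_norm_le {d : PseudoMetric (Fin D → ℝ) ℝ}
    (hCT : CombesThomasBound P 𝔒 d HO)
    (hm : ∀ U ∈ 𝔒, IsMeasurableSelfAdjointFamily (HO U))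
    (hp : ∀ U ∈ 𝔒, ∀ ω, HasPurePointSpectrum (HO U ω)) {R : ℝ} (hR : 0 ≤ R) :
    ∃ C m : ℝ, 0 < C ∧ 0 < m ∧ ∀ x y : Fin D → ℝ, ∀ U ∈ 𝔒, ∀ᵐ ω ∂P, ∀ ζ : ℂ,
      1 / 2 ≤ |ζ.im| → ‖ζ‖ ≤ R →
        ‖chi U x ∘L opResolvent (HO U ω) ζ ∘L chi U y‖ ≤ C * Real.exp (-m * d x y) := by
  obtain ⟨C₀, μ₀, hC₀, hμ₀, h⟩ := hCT
  refine ⟨2 * C₀, μ₀ * (1 / 2) / (1 + R + 1 / 2), by positivity, by positivity,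
    fun x y U hU => ?_⟩
  filter_upwards [h x y U hU] with ω hω ζ hζ hζR
  have hζ0 : ζ.im ≠ 0 := abs_pos.mp (by linarith)
  have h1 := hω ζ (notMem_opSpectrum ((hm U hU).1 ω) (hp U hU ω) hζ0)
  -- For empty spectrum `Metric.infDist` is 0 and division by it gives 0, so the hypothesis reads
  -- ‖·‖ ≤ 0.
  rcases (opSpectrum (HO U ω)).eq_empty_or_nonempty with he | hne
  · rw [he, Metric.infDist_empty, div_zero, zero_mul] at h1
    exact h1.trans (by positivity)
  have hΔ : 1 / 2 ≤ Metric.infDist ζ (opSpectrum (HO U ω)) :=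
    hζ.trans (abs_im_le_infDist_opSpectrum ((hm U hU).1 ω) (hp U hU ω) hne ζ)
  set Δ := Metric.infDist ζ (opSpectrum (HO U ω))
  have hΔ0 : 0 < Δ := by linarith
  refine h1.trans (mul_le_mul ?_ (Real.exp_le_exp.mpr ?_) (Real.exp_pos _).le (by positivity))
  · rw [div_le_iff₀ hΔ0]; nlinarith
  -- Δ/(1+|ζ|+Δ) increases in Δ and decreases in |ζ|, hence is least at Δ = 1/2, |ζ| = R.
  · refine mul_le_mul_of_nonneg_right ?_ (d.nonneg x y)
    rw [neg_mul, neg_div, neg_le_neg_iff, div_le_div_iff₀ (by positivity) (by positivity)]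
    have h2 := norm_nonneg ζ
    have h3 : 1 / 2 * (1 + ‖ζ‖ + Δ) ≤ Δ * (1 + R + 1 / 2) := by nlinarith
    nlinarith

theorem lintegral_tsum_resolvent_weight_le
    (hm : ∀ U ∈ 𝔒, IsMeasurableSelfAdjointFamily (HO U))
    (hp : ∀ U ∈ 𝔒, ∀ ω, HasPurePointSpectrum (HO U ω))
    {I : Set ℝ} (hI : I.OrdConnected) {d : PseudoMetric (Fin D → ℝ) ℝ} {K ν γ θ s ρ : ℝ}
    (hK : 0 < K) (hρ : 0 < ρ) (hs0 : 0 < s) (hs1 : s ≤ 1) (hsθ : s < 1 - θ)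
    (h : ∀ x y : Fin D → ℝ, ∀ U ∈ 𝔒, ∀ S : Set ℝ, S.OrdConnected → S ⊆ I →
      ∀ v : ℝ, 0 ≤ v → volume S ≤ ENNReal.ofReal v →
      ∫⁻ ω, eigenSum (HO U ω) S s x y ∂P
        ≤ ENNReal.ofReal (K * v ^ (1 - θ) * Real.exp (-ν * d x y ^ γ))) :
    ∃ A : ℝ, 0 ≤ A ∧ ∀ x y : Fin D → ℝ, ∀ U ∈ 𝔒, ∀ z : ℂ, z.im ≠ 0 →
      I ⊆ Metric.closedBall z.re ρ →
      ∫⁻ ω, ∑' a : ℝ, I.indicator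
          (fun a => (‖(a : ℂ) - z‖ₑ⁻¹ * eigenKernel (HO U ω) x y a) ^ s) a ∂P
        ≤ ENNReal.ofReal (A * Real.exp (-ν * d x y ^ γ)) := by
  have hsum := (summable_dyadic hρ hsθ).mul_left K
  refine ⟨∑' k : ℕ, K * ((2 ^ (k + 1) / ρ) ^ s * (2 * (ρ * (1 / 2) ^ k)) ^ (1 - θ)),
    tsum_nonneg fun k => by positivity, fun x y U hU z hz hIz => ?_⟩
  have hcon : ∀ k : ℕ, (I ∩ Metric.closedBall z.re (ρ * (1 / 2) ^ k)).OrdConnected := fun k =>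
    hI.inter (by rw [Real.closedBall_eq_Icc]; exact Set.ordConnected_Icc)
  calc ∫⁻ ω, ∑' a : ℝ, I.indicator
          (fun a => (‖(a : ℂ) - z‖ₑ⁻¹ * eigenKernel (HO U ω) x y a) ^ s) a ∂P
      ≤ ∫⁻ ω, ∑' k : ℕ, ENNReal.ofReal ((2 ^ (k + 1) / ρ) ^ s)
          * eigenSum (HO U ω) (I ∩ Metric.closedBall z.re (ρ * (1 / 2) ^ k)) s x y ∂P :=
        lintegral_mono fun ω => tsum_indicator_le_tsum_eigenSum _ hz hρ hIz hs0 x y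
    _ = ∑' k : ℕ, ENNReal.ofReal ((2 ^ (k + 1) / ρ) ^ s)
          * ∫⁻ ω, eigenSum (HO U ω) (I ∩ Metric.closedBall z.re (ρ * (1 / 2) ^ k)) s x y ∂P := by
        rw [lintegral_tsum fun k => ((measurable_eigenSum (hp U hU) (hm U hU)
          (hcon k).measurableSet hs0 hs1 x y).const_mul _).aemeasurable]
        exact tsum_congr fun k => lintegral_const_mul' _ _ ENNReal.ofReal_ne_top
    _ ≤ ∑' k : ℕ, ENNReal.ofReal (K * ((2 ^ (k + 1) / ρ) ^ s
          * (2 * (ρ * (1 / 2) ^ k)) ^ (1 - θ)) * Real.exp (-ν * d x y ^ γ)) := by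
        refine ENNReal.tsum_le_tsum fun k => ?_
        refine (mul_le_mul_right (h x y U hU _ (hcon k) Set.inter_subset_left
          (2 * (ρ * (1 / 2) ^ k)) (by positivity)
          ((measure_mono Set.inter_subset_right).trans (Real.volume_closedBall _ _).le)) _).trans
          (le_of_eq ?_)
        rw [← ENNReal.ofReal_mul (by positivity)]
        congr 1; ring
    _ = _ := by
        rw [← ENNReal.ofReal_tsum_of_nonneg (fun k => by positivity) (hsum.mul_right _),
          tsum_mul_right]

/-- Hölder's inequality reduces small moments to large ones. -/
theorem lintegral_rpow_le_of_le [IsProbabilityMeasure P] {f : Ω → ℝ≥0∞} {A ν t s s' : ℝ}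
    (hA : 0 ≤ A) (hν : 0 ≤ ν) (ht : 0 ≤ t) (hs : 0 < s) (hss' : s ≤ s') (hs' : s' ≤ 1)
    (h : ∫⁻ ω, f ω ^ s' ∂P ≤ ENNReal.ofReal (A * Real.exp (-ν * t))) :
    ∫⁻ ω, f ω ^ s ∂P ≤ ENNReal.ofReal ((1 + A) * Real.exp (-(ν * s / 2) * t)) := by
  -- Thresholding at k gives f^s ≤ k^s + k^(s - s') f^s'. Half of the rate ν is kept so that the
  -- second factor does not destroy the decay.
  set k := Real.exp (-(ν / 2) * t) with hk
  have hk0 : 0 < k := Real.exp_pos _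
  have hkE : ENNReal.ofReal k ≠ 0 := by simpa using hk0
  have hpt : ∀ a : ℝ≥0∞, a ^ s ≤ ENNReal.ofReal (k ^ s) + ENNReal.ofReal (k ^ (s - s')) * a ^ s' := by
    intro a
    rw [← ENNReal.ofReal_rpow_of_pos hk0, ← ENNReal.ofReal_rpow_of_pos hk0]
    rcases le_total a (ENNReal.ofReal k) with hak | hak
    · exact le_add_right (ENNReal.rpow_le_rpow hak hs.le)
    · refine le_add_left ?_
      rcases eq_or_ne a ∞ with rfl | ha
      · rw [ENNReal.top_rpow_of_pos (hs.trans_le hss'), ENNReal.mul_top]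
        · exact le_top
        · exact (ENNReal.rpow_pos (pos_iff_ne_zero.mpr hkE) ENNReal.ofReal_ne_top).ne'
      have ha0 : a ≠ 0 := fun h0 => hkE (le_antisymm (h0 ▸ hak) zero_le)
      calc a ^ s = a ^ (s - s') * a ^ s' := by
            rw [← ENNReal.rpow_add _ _ ha0 ha]; congr 1; ring
        _ ≤ _ := by
            refine mul_le_mul_left ?_ _
            rw [← neg_sub s' s, ENNReal.rpow_neg, ENNReal.rpow_neg, ENNReal.inv_le_inv]
            exact ENNReal.rpow_le_rpow hak (by linarith)
  calc ∫⁻ ω, f ω ^ s ∂P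
      ≤ ∫⁻ ω, (ENNReal.ofReal (k ^ s) + ENNReal.ofReal (k ^ (s - s')) * f ω ^ s') ∂P :=
        lintegral_mono fun ω => hpt (f ω)
    _ = ENNReal.ofReal (k ^ s) + ENNReal.ofReal (k ^ (s - s')) * ∫⁻ ω, f ω ^ s' ∂P := by
        rw [lintegral_add_left measurable_const, lintegral_const_mul' _ _ ENNReal.ofReal_ne_top,
          lintegral_const, measure_univ, mul_one]
    _ ≤ ENNReal.ofReal (k ^ s)
          + ENNReal.ofReal (k ^ (s - s')) * ENNReal.ofReal (A * Real.exp (-ν * t)) := by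
        gcongr
    _ ≤ _ := by
        rw [← ENNReal.ofReal_mul (by positivity),
          ← ENNReal.ofReal_add (by positivity) (by positivity)]
        refine ENNReal.ofReal_le_ofReal ?_
        have e1 : k ^ s = Real.exp (-(ν * s / 2) * t) := by
          rw [hk, ← Real.exp_mul]; congr 1; ring
        have e2 : k ^ (s - s') * Real.exp (-ν * t) ≤ Real.exp (-(ν * s / 2) * t) := by
          rw [hk, ← Real.exp_mul, ← Real.exp_add]
          refine Real.exp_le_exp.mpr ?_
          have h1 : 0 ≤ ν * t := by positivity
          nlinarith
        rw [e1]
        nlinarith [mul_le_mul_of_nonneg_left e2 hA]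

/-- Exponential decay of the fractional moments of order `s ∈ (1/2, 1)`. -/
theorem exists_lintegral_resolvent_rpow_le [IsProbabilityMeasure P]
    (hm : ∀ U ∈ 𝔒, IsMeasurableSelfAdjointFamily (HO U))
    (hp : ∀ U ∈ 𝔒, ∀ ω, HasPurePointSpectrum (HO U ω))
    {d : PseudoMetric (Fin D → ℝ) ℝ} (hM : IsSummablePseudoMetric d)
    (hW : WegnerEstimate P 𝔒 HO) (hCT : CombesThomasBound P 𝔒 d HO)
    {I J : Set ℝ} (hI : I.OrdConnected) (hIb : Bornology.IsBounded I) (hJI : J ⊆ I)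
    (hdist : ∃ δ : ℝ, 0 < δ ∧ ∀ a ∈ J, ∀ b ∈ frontier I, δ ≤ dist a b)
    {C μ γ : ℝ} (hC : 0 < C) (hμ : 0 < μ) (hγ : γ ∈ Set.Ioc (0 : ℝ) 1)
    (hEC : ∀ x y : Fin D → ℝ, ∀ U ∈ 𝔒,
      ∫⁻ ω, eigenfunctionCorrelator (HO U ω) I x y ∂P
        ≤ ENNReal.ofReal (C * Real.exp (-μ * d x y ^ γ)))
    {s : ℝ} (hs0 : 1 / 2 < s) (hs1 : s < 1) :
    ∃ A ν : ℝ, 0 < A ∧ 0 < ν ∧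
      ∀ x y : Fin D → ℝ, ∀ U ∈ 𝔒, ∀ z : ℂ, z.re ∈ J → 0 < |z.im| → |z.im| < 1 →
        ∫⁻ ω, ‖chi U x ∘L opResolvent (HO U ω) z ∘L chi U y‖ₑ ^ s ∂P
          ≤ ENNReal.ofReal (A * Real.exp (-ν * d x y ^ γ)) := by
  have hspos : 0 < s := by linarith
  obtain ⟨δ, hδ, hδJ⟩ := hdist
  obtain ⟨R, hR, hIR⟩ : ∃ R : ℝ, 0 < R ∧ ∀ a ∈ I, |a| ≤ R := by
    obtain ⟨R, hR, h⟩ := hIb.exists_pos_norm_le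
    exact ⟨R, hR, h⟩
  -- With θ = (1 - s)/2 one has 1 - θ = (1 + s)/2 > s, as the dyadic sum requires.
  obtain ⟨K, ν, hK, hν, hKν⟩ := lintegral_eigenSum_rpow_le hm hp hW hI hIb hM hC hμ hγ hEC
    (θ := (1 - s) / 2) (by linarith) (by linarith) hs0 hs1
  obtain ⟨A, hA, hAle⟩ := lintegral_tsum_resolvent_weight_le hm hp hI hK
    (show 0 < 2 * R by linarith) hspos hs1.le (by linarith) hKν
  obtain ⟨C₁, m, hC₁, hm₁, hCTm⟩ := hCT.exists_norm_le hm hp (show 0 ≤ R + 3 / 2 by linarith)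
  obtain ⟨K₂, c, hK₂, hc, hKc⟩ := exists_two_pow_mul_exp_add_pow_le hC₁ hm₁ hδ
  refine ⟨A + K₂ ^ s * Real.exp (c * s), min ν (c * s), by positivity, by positivity,
    fun x y U hU z hzJ hz0 hz1 => ?_⟩
  have hzre : |z.re| ≤ R := hIR _ (hJI hzJ)
  have hzim : z.im ≠ 0 := abs_pos.mp hz0
  -- The truncation order depends on d(x,y) only, not on ω or z.
  obtain ⟨n, hn⟩ := hKc (d x y) (d.nonneg x y)
  have ht : 0 ≤ d x y ^ γ := Real.rpow_nonneg (d.nonneg x y) γ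
  have hball : I ⊆ Metric.closedBall z.re (2 * R) := fun a ha => by
    rw [Metric.mem_closedBall, Real.dist_eq]
    exact (abs_sub _ _).trans (by linarith [hIR a ha])
  have hoff : ∀ a ∉ I, δ ≤ |a - z.re| := fun a ha => by
    obtain ⟨b, hb, hab⟩ := exists_mem_frontier_abs_sub_le (hJI hzJ) ha
    refine (hδJ _ hzJ b hb).trans ?_
    rwa [dist_comm, Real.dist_eq]
  have hpt : ∀ᵐ ω ∂P, ‖chi U x ∘L opResolvent (HO U ω) z ∘L chi U y‖ₑ ^ s
      ≤ ∑' a : ℝ, I.indicator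
          (fun a => (‖(a : ℂ) - z‖ₑ⁻¹ * eigenKernel (HO U ω) x y a) ^ s) a
        + ENNReal.ofReal (K₂ * Real.exp (-c * d x y)) ^ s := by
    filter_upwards [hCTm x y U hU] with ω hω
    have h1 := enorm_comp_opResolvent_comp_le ((hm U hU).1 ω) (hp U hU ω) (norm_chi_le U x)
      (norm_chi_le U y) hz0 hz1 hδ hoff (fun ζ h1 h2 => hω ζ h1 (h2.trans (by linarith))) n
    refine (ENNReal.rpow_le_rpow (h1.trans (add_le_add_right (ENNReal.ofReal_le_ofReal hn) _))
      hspos.le).trans ?_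
    refine (ENNReal.rpow_add_le_add_rpow _ _ hspos.le hs1.le).trans (add_le_add_left ?_ _)
    refine (tsum_rpow_le _ hspos hs1.le).trans (ENNReal.tsum_le_tsum fun a => ?_)
    by_cases ha : a ∈ I
    · simp only [Set.indicator_of_mem ha, eigenKernel]; exact le_rfl
    · simp [ha, hspos]
  calc ∫⁻ ω, ‖chi U x ∘L opResolvent (HO U ω) z ∘L chi U y‖ₑ ^ s ∂P
      ≤ ∫⁻ ω, (∑' a : ℝ, I.indicator
          (fun a => (‖(a : ℂ) - z‖ₑ⁻¹ * eigenKernel (HO U ω) x y a) ^ s) a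
        + ENNReal.ofReal (K₂ * Real.exp (-c * d x y)) ^ s) ∂P := lintegral_mono_ae hpt
    _ = ∫⁻ ω, ∑' a : ℝ, I.indicator
          (fun a => (‖(a : ℂ) - z‖ₑ⁻¹ * eigenKernel (HO U ω) x y a) ^ s) a ∂P
        + ENNReal.ofReal (K₂ * Real.exp (-c * d x y)) ^ s := by
        rw [lintegral_add_right _ measurable_const, lintegral_const, measure_univ, mul_one]
    _ ≤ ENNReal.ofReal (A * Real.exp (-ν * d x y ^ γ))
        + ENNReal.ofReal (K₂ ^ s * Real.exp (c * s) * Real.exp (-(c * s) * d x y ^ γ)) := by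
        refine add_le_add (hAle x y U hU z hzim hball) ?_
        rw [ENNReal.ofReal_rpow_of_pos (by positivity)]
        refine ENNReal.ofReal_le_ofReal ?_
        rw [Real.mul_rpow hK₂.le (Real.exp_pos _).le, ← Real.exp_mul,
          mul_assoc (K₂ ^ s), ← Real.exp_add]
        refine mul_le_mul_of_nonneg_left (Real.exp_le_exp.mpr ?_) (by positivity)
        -- As d^γ ≤ 1 + d, decay in d implies decay in d^γ at the cost of the factor exp(c s).
        have h2 := mul_le_mul_of_nonneg_left (rpow_le_one_add (d.nonneg x y) hγ)
          (show 0 ≤ c * s by positivity)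
        linarith
    _ ≤ _ := by
        rw [← ENNReal.ofReal_add (by positivity) (by positivity), add_mul]
        refine ENNReal.ofReal_le_ofReal ?_
        gcongr
        · exact min_le_left _ _
        · exact min_le_right _ _

end FractionalMoments

end RandomOperator

end

theorem theorem2p3 {D : ℕ} {Ω : Type*} [MeasurableSpace Ω] (P : Measure Ω) [IsProbabilityMeasure P]
    (H : Ω → RandomOperator.L2 (Set.univ : Set (Fin D → ℝ)) →ₗ.[ℂ]
      RandomOperator.L2 (Set.univ : Set (Fin D → ℝ)))
    (hH : RandomOperator.IsMeasurableSelfAdjointFamily H)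
    (𝔒 : Set (Set (Fin D → ℝ)))
    (HO : (U : Set (Fin D → ℝ)) → Ω → RandomOperator.L2 U →ₗ.[ℂ] RandomOperator.L2 U)
    (hO : RandomOperator.IsRestrictionFamily 𝔒 H HO)
    (d : PseudoMetric (Fin D → ℝ) ℝ) (hM : RandomOperator.IsSummablePseudoMetric d)
    (hW : RandomOperator.WegnerEstimate P 𝔒 HO)
    (hCT : RandomOperator.CombesThomasBound P 𝔒 d HO)
    (I J : Set ℝ) (hI : I.OrdConnected) (hIb : Bornology.IsBounded I)
    (hJ : J.OrdConnected) (hJI : J ⊆ I)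
    (hdist : ∃ δ : ℝ, 0 < δ ∧ ∀ a ∈ J, ∀ b ∈ frontier I, δ ≤ dist a b)
    (C μ γ : ℝ) (hC : 0 < C) (hμ : 0 < μ) (hγ : γ ∈ Set.Ioc (0 : ℝ) 1)
    (hEC : ∀ x y : Fin D → ℝ, ∀ U ∈ 𝔒,
      ∫⁻ ω, RandomOperator.eigenfunctionCorrelator (HO U ω) I x y ∂P
        ≤ ENNReal.ofReal (C * Real.exp (-μ * d x y ^ γ)))
    (s : ℝ) (hs : s ∈ Set.Ioo (0 : ℝ) 1) :
    ∃ A ν : ℝ, 0 < A ∧ 0 < ν ∧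
      ∀ x y : Fin D → ℝ, ∀ U ∈ 𝔒, ∀ z : ℂ, z.re ∈ J → 0 < |z.im| → |z.im| < 1 →
        ∫⁻ ω, ‖RandomOperator.chi U x ∘L RandomOperator.opResolvent (HO U ω) z ∘L
            RandomOperator.chi U y‖ₑ ^ s ∂P
          ≤ ENNReal.ofReal (A * Real.exp (-ν * d x y ^ γ)) := by
  have hm := hO.measurable_selfAdjoint
  have hp := hO.purePoint
  -- The order is raised to max(s, 3/4), which lies in the range (1/2, 1) of the interpolation.
  obtain ⟨A, ν, hA, hν, h⟩ := RandomOperator.exists_lintegral_resolvent_rpow_le hm hp hM hW hCT hI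
    hIb hJI hdist hC hμ hγ hEC (s := max s (3 / 4))
    (lt_max_of_lt_right (by norm_num)) (max_lt hs.2 (by norm_num))
  refine ⟨1 + A, ν * s / 2, by positivity, by have := hs.1; positivity,
    fun x y U hU z hz hz0 hz1 => ?_⟩
  exact RandomOperator.lintegral_rpow_le_of_le hA.le hν.le (Real.rpow_nonneg (d.nonneg x y) γ) hs.1
    (le_max_left _ _) (max_le hs.2.le (by norm_num)) (h x y U hU z hz hz0 hz1)
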